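/- Let $n\ge 1$, $\alpha\in(0,1)$. For $\varphi\in C_c^\infty(\mathbb R^n;\mathbb R^n)$ let $$\operatorname{div}^\alpha\varphi(x)=\mu_{n,\alpha}\int_{\mathbb R^n}\frac{\varphi(y)-\varphi(x)}{|y-x|^{n+\alpha}}\cdot\frac{y-x}{|y-x|}\,dy,\qquad \mu_{n,\alpha}=2^\alpha\pi^{-n/2}\,\frac{\Gamma((n+\alpha+1)/2)}{\Gamma((1-\alpha)/2)}.$$ A function $u\in L^1(\mathbb R^n)$ belongs to $BV^\alpha(\mathbb R^n)$ if $\sup\{\int_{\mathbb R^n}u\,\operatorname{div}^\alpha\varphi\,dx:\varphi\in C_c^\infty(\mathbb R^n;\mathbb R^n),\ \|\varphi\|_{L^\infty}\le 1\}<\infty$. In that case $D^\alpha u$ denotes the (unique) finite $\mathbb R^n$-valued Radon measure on $\mathbb R^n$ with $\int_{\mathbb R^n}u\,\operatorname{div}^\alpha\varphi\,dx=-\int_{\mathbb R^n}\varphi\cdot dD^\alpha u$ for all $\varphi\in C_c^\infty(\mathbb R^n;\mathbb R^n)$, $|D^\alpha u|$ denotes its total variation measure, and $\|u\|_{BV^\alpha(\mathbb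 R^n)}=\|u\|_{L^1(\mathbb R^n)}+|D^\alpha u|(\mathbb R^n)$. For $\Omega\subset\mathbb R^n$ open and bounded, let $BV^\alpha_0(\Omega)$ be the set of $u\in BV^\alpha(\mathbb R^n)$ with $u=0$ a.e. in $\mathbb R^n\setminus\Omega$. Proposition 3.4. For every open and bounded $\Omega\subset\mathbb R^n$ there exist an open and bounded set $\Omega'\subset\mathbb R^n$ with $\overline\Omega\subset\Omega'$ and $\overline\Omega$ compact, and a constant $C=C(\Omega,n,\alpha)>0$, such that $$\|u\|_{BV^\alpha(\mathbb R^n)}\le C\,|D^\alpha u|(\Omega')\qquad\text{for all }u\in BV^\alpha_0(\Omega).$$ -/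

import Mathlib

open MeasureTheory
open scoped ENNReal ContDiff

noncomputable section

namespace FracBV

variable {n : ℕ}

/-- The normalising constant `μ_{n,α} = 2^α π^{-n/2} Γ((n+α+1)/2) / Γ((1-α)/2)`. -/
def gradConst (n : ℕ) (α : ℝ) : ℝ :=
  (2 : ℝ) ^ α * Real.pi ^ (-(n : ℝ) / 2) *
    (Real.Gamma (((n : ℝ) + α + 1) / 2) / Real.Gamma ((1 - α) / 2))

/-- The fractional divergence
`div^α φ (x) = μ_{n,α} ∫ (φ(y) - φ(x)) / |y-x|^(n+α) · (y-x) / |y-x| dy`. -/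
def fracDiv (α : ℝ) (φ : EuclideanSpace ℝ (Fin n) → EuclideanSpace ℝ (Fin n))
    (x : EuclideanSpace ℝ (Fin n)) : ℝ :=
  gradConst n α *
    ∫ y, inner ℝ (φ y - φ x) (y - x) / ‖y - x‖ ^ ((n : ℝ) + α + 1)

/-- Smooth compactly supported vector fields on `ℝⁿ`. -/
def IsTestField (φ : EuclideanSpace ℝ (Fin n) → EuclideanSpace ℝ (Fin n)) : Prop :=
  ContDiff ℝ ∞ φ ∧ HasCompactSupport φ

/-- The space `BV^α(ℝⁿ)`: integrable functions for which the supremum of `∫ u div^α φ dx`, over all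
test fields `φ` with `‖φ‖_∞ ≤ 1`, is finite. -/
def MemBV (α : ℝ) (u : EuclideanSpace ℝ (Fin n) → ℝ) : Prop :=
  Integrable u ∧
    BddAbove {t : ℝ | ∃ φ : EuclideanSpace ℝ (Fin n) → EuclideanSpace ℝ (Fin n),
      IsTestField φ ∧ (∀ x, ‖φ x‖ ≤ 1) ∧ t = ∫ x, u x * fracDiv α φ x}

/-- The Euclidean inner product as a real bilinear map, used to pair vector fields with
vector-valued measures. -/
def innerPairing (n : ℕ) :
    EuclideanSpace ℝ (Fin n) →L[ℝ] EuclideanSpace ℝ (Fin n) →L[ℝ] ℝ :=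
  innerSL ℝ

/-- `μ` is a fractional variation measure of `u`: a vector-valued Borel measure of finite total
variation with `∫ u div^α φ dx = - ∫ φ · dμ` for all test fields `φ`. -/
def IsFracVariation (α : ℝ) (u : EuclideanSpace ℝ (Fin n) → ℝ)
    (μ : VectorMeasure (EuclideanSpace ℝ (Fin n)) (EuclideanSpace ℝ (Fin n))) : Prop :=
  μ.variation Set.univ < ⊤ ∧
    ∀ φ : EuclideanSpace ℝ (Fin n) → EuclideanSpace ℝ (Fin n), IsTestField φ →
      ∫ x, u x * fracDiv α φ x = - μ.integral φ (innerPairing n)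

open Classical in
/-- The fractional variation measure `D^α u` (with the junk value `0` if there is none; for
`u ∈ BV^α(ℝⁿ)` it exists and is unique). -/
def fracVariation (α : ℝ) (u : EuclideanSpace ℝ (Fin n) → ℝ) :
    VectorMeasure (EuclideanSpace ℝ (Fin n)) (EuclideanSpace ℝ (Fin n)) :=
  if h : ∃ μ, IsFracVariation α u μ then h.choose else 0

/-- The total variation measure `|D^α u|`, with respect to the Euclidean norm on the values. -/
def totalFracVariation (α : ℝ) (u : EuclideanSpace ℝ (Fin n) → ℝ) :
    Measure (EuclideanSpace ℝ (Fin n)) :=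
  (fracVariation α u).variation

/-- The norm `‖u‖_{BV^α(ℝⁿ)} = ‖u‖_{L¹(ℝⁿ)} + |D^α u|(ℝⁿ)`, as an extended nonnegative real. -/
def bvNorm (α : ℝ) (u : EuclideanSpace ℝ (Fin n) → ℝ) : ℝ≥0∞ :=
  eLpNorm u 1 volume + totalFracVariation α u Set.univ

/-- The complementary-value space `BV^α_0(Ω)`. -/
def MemBVZero (α : ℝ) (Ω : Set (EuclideanSpace ℝ (Fin n)))
    (u : EuclideanSpace ℝ (Fin n) → ℝ) : Prop :=
  MemBV α u ∧ ∀ᵐ x, x ∈ Ωᶜ → u x = 0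

/-- `E` is compactly contained in `F`. -/
def CompactlyContained (E F : Set (EuclideanSpace ℝ (Fin n))) : Prop :=
  closure E ⊆ F ∧ IsCompact (closure E)

end FracBV

end

set_option linter.unusedSectionVars false

/-! The `L¹` norm of `u` is tested against smooth `f` with `|f| ≤ 1` supported in a ball of radius
`2R`, where `Ω` lies in the ball of radius `R`. The point is to write such an `f`, up to a small
error, as a fractional divergence of a compactly supported field, so that only the variation on a
bounded set is seen.

With `ψ(z) = z` on the annulus `1 ≤ ‖z‖ ≤ 2` and `0` elsewhere, let `Φ(x) = ∫₀ᵀ ∫ t^(α-1) f(x - t z)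
ψ(z) dz dt` (`potentialField`). Put `β = n + α - 1`. The fractional derivative is a Riesz potential
of the classical one (`fracDirDeriv_eq_integral_fderiv`), and the potential of `ψ` with kernel
`‖·‖^(-β)` is radial, equal to `P(y) y` (`rieszField_eq_smul`). After scaling, the contribution of
the scale `t` to `β div^α Φ / μ_{n,α}` is `∫ P(y) ∇f(x - t y)·y dy = -d/dt ∫ P(y) f(x - t y) dy`. It
telescopes: `div^α Φ(x) = κ (c f(x) - ∫ P(y) f(x - T y) dy)` with `c = ∫ P > 0` and `κ = μ_{n,α}/β`
(`fracDiv_potentialField`). For `T` large the last integral is at most `c/2` in absolute value on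
the ball of radius `R`, because only `y` near `0` contribute. Pairing with `u` and absorbing half of
`‖u‖₁` gives `‖u‖₁ ≤ C |D^α u|(B)` for a large ball `B` (`exists_integral_abs_le_variation`).

Outside the ball of radius `2R` the kernel is not singular relative to the support of `u`, so there
`|D^α u|` has mass at most `C ‖u‖₁` (`exists_variation_far_le`). The two bounds together give the
theorem.

Since `fracVariation` is `0` when no representing measure exists, existence has to be proved as
well: Hahn–Banach and Riesz–Markov on the product of space and the unit sphere
(`exists_vectorMeasure_of_forall_le`). -/

namespace FracBV

/-! ### Weakly singular kernels; the fractional derivative as a Riesz potential. -/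

section Kernels

variable {V : Type*} [NormedAddCommGroup V] [InnerProductSpace ℝ V] [FiniteDimensional ℝ V]
  [MeasurableSpace V] [BorelSpace V]

open Module

/-- Negative powers of the norm of order less than the dimension are integrable on balls. -/
theorem integrableOn_ball_norm_rpow_neg [Nontrivial V] {s : ℝ} (hs : s < finrank ℝ V) (r : ℝ) :
    IntegrableOn (fun x : V => ‖x‖ ^ (-s)) (Metric.ball 0 r) := by
  rcases le_or_gt r 0 with hr | hr
  · simp [Metric.ball_eq_empty.2 hr]
  rw [integrableOn_fun_norm_addHaar (μ := volume) (f := fun t : ℝ => t ^ (-s))]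
  have hd : 1 ≤ finrank ℝ V := Module.finrank_pos
  have h := (intervalIntegral.intervalIntegrable_rpow' (a := 0) (b := r)
    (r := (finrank ℝ V : ℝ) - 1 - s) (by linarith))
  rw [intervalIntegrable_iff_integrableOn_Ioo_of_le hr.le] at h
  refine h.congr_fun (fun t ht => ?_) measurableSet_Ioo
  have ht0 : 0 < t := ht.1
  simp only [smul_eq_mul]
  rw [← Real.rpow_natCast, ← Real.rpow_add ht0, Nat.cast_sub hd]
  congr 1
  push_cast; ring

theorem norm_rpow_neg_le_indicator_add_one {s : ℝ} (hs : 0 ≤ s) (w : V) :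
    ‖w‖ ^ (-s) ≤ (Metric.ball (0 : V) 1).indicator (fun x => ‖x‖ ^ (-s)) w + 1 := by
  by_cases hw : w ∈ Metric.ball (0 : V) 1
  · rw [Set.indicator_of_mem hw]; linarith
  · rw [Set.indicator_of_notMem hw, zero_add]
    rw [mem_ball_zero_iff, not_lt] at hw
    exact Real.rpow_le_one_of_one_le_of_nonpos hw (by linarith)

/-- The convolution of a weakly singular kernel with the indicator of a ball is bounded. -/
theorem exists_integral_ball_norm_sub_rpow_neg_le [Nontrivial V] {s : ℝ} (hs0 : 0 ≤ s)
    (hs : s < finrank ℝ V) (R : ℝ) :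
    ∃ C : ℝ, 0 ≤ C ∧ ∀ v : V,
      IntegrableOn (fun z => ‖v - z‖ ^ (-s)) (Metric.ball 0 R) ∧
      ∫ z in Metric.ball (0 : V) R, ‖v - z‖ ^ (-s) ≤ C := by
  set g : V → ℝ := (Metric.ball (0 : V) 1).indicator (fun x => ‖x‖ ^ (-s)) with hg
  have hgi : Integrable g :=
    (integrable_indicator_iff measurableSet_ball).2 (integrableOn_ball_norm_rpow_neg hs 1)
  have hg0 : ∀ x, 0 ≤ g x := fun x => Set.indicator_nonneg (fun x _ => by positivity) x
  refine ⟨(∫ x, g x) + volume.real (Metric.ball (0 : V) R), by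
    have := integral_nonneg (μ := volume) (f := g) (fun x => hg0 x); positivity, fun v => ?_⟩
  have hgv : Integrable (fun z => g (v - z)) := hgi.comp_sub_left v
  have h1 : IntegrableOn (fun _ : V => (1 : ℝ)) (Metric.ball 0 R) :=
    integrableOn_const measure_ball_lt_top.ne
  have hb : IntegrableOn (fun z => g (v - z) + 1) (Metric.ball (0 : V) R) :=
    hgv.integrableOn.add h1
  have hi : IntegrableOn (fun z => ‖v - z‖ ^ (-s)) (Metric.ball 0 R) := by
    refine hb.mono' (Measurable.aestronglyMeasurable (by fun_prop)) (ae_of_all _ fun z => ?_)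
    rw [Real.norm_of_nonneg (by positivity)]
    exact norm_rpow_neg_le_indicator_add_one hs0 _
  refine ⟨hi, ?_⟩
  calc ∫ z in Metric.ball (0 : V) R, ‖v - z‖ ^ (-s)
      ≤ ∫ z in Metric.ball (0 : V) R, (g (v - z) + 1) :=
        setIntegral_mono hi hb fun z => norm_rpow_neg_le_indicator_add_one hs0 _
    _ = (∫ z in Metric.ball (0 : V) R, g (v - z)) + volume.real (Metric.ball (0 : V) R) := by
        rw [integral_add hgv.integrableOn h1]; simp
    _ ≤ _ := by
        gcongr
        calc ∫ z in Metric.ball (0 : V) R, g (v - z) ≤ ∫ z, g (v - z) :=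
              setIntegral_le_integral hgv (ae_of_all _ fun z => hg0 _)
          _ = ∫ x, g x := integral_sub_left_eq_self g volume v

/-- The majorant of the singular integrands defining fractional derivatives of order `α`. -/
noncomputable def singularMajorant (α : ℝ) (h : V) : ℝ :=
  min 1 ‖h‖ * ‖h‖ ^ (-((finrank ℝ V : ℝ) + α))

theorem singularMajorant_nonneg (α : ℝ) (h : V) : 0 ≤ singularMajorant α h := by
  unfold singularMajorant; positivity

/-- With `d` the dimension, the majorant has order `d + α - 1 < d` at the origin, which uses `α <
1`, and decays with order `d + α > d` at infinity, which uses `α > 0`. -/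
theorem integrable_singularMajorant [Nontrivial V] {α : ℝ} (hα₀ : 0 < α) (hα₁ : α < 1) :
    Integrable (singularMajorant α : V → ℝ) := by
  have hm : Measurable (singularMajorant α : V → ℝ) := by
    unfold singularMajorant; fun_prop
  rw [← integrableOn_univ, ← Set.union_compl_self (Metric.ball (0 : V) 1)]
  refine IntegrableOn.union ?_ ?_
  · refine (integrableOn_ball_norm_rpow_neg (V := V) (s := (finrank ℝ V : ℝ) + α - 1)
      (by linarith) 1).mono' hm.aestronglyMeasurable (ae_of_all _ fun h => ?_)
    rw [Real.norm_of_nonneg (singularMajorant_nonneg α h), singularMajorant]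
    rcases eq_or_ne h 0 with rfl | hh
    · simp; positivity
    have h0 : 0 < ‖h‖ := norm_pos_iff.2 hh
    calc _ ≤ ‖h‖ ^ (1 : ℝ) * ‖h‖ ^ (-((finrank ℝ V : ℝ) + α)) := by
          rw [Real.rpow_one]; gcongr; exact min_le_right _ _
      _ = _ := by rw [← Real.rpow_add h0]; congr 1; ring
  · have h2 : Integrable (fun h : V => (2 : ℝ) ^ ((finrank ℝ V : ℝ) + α) *
        (1 + ‖h‖) ^ (-((finrank ℝ V : ℝ) + α))) :=
      (integrable_one_add_norm (by linarith)).const_mul _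
    refine h2.integrableOn.mono' hm.aestronglyMeasurable ?_
    refine (ae_restrict_iff' measurableSet_ball.compl).2 (ae_of_all _ fun h hh => ?_)
    have h1 : 1 ≤ ‖h‖ := by simpa using hh
    rw [Real.norm_of_nonneg (singularMajorant_nonneg α h), singularMajorant, min_eq_left h1, one_mul]
    have : (2 : ℝ) ^ ((finrank ℝ V : ℝ) + α) = (2⁻¹ : ℝ) ^ (-((finrank ℝ V : ℝ) + α)) := by
      rw [Real.rpow_neg (by norm_num), Real.inv_rpow (by norm_num), inv_inv]
    rw [this, ← Real.mul_rpow (by norm_num) (by positivity)]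
    refine Real.rpow_le_rpow_of_nonpos (by positivity) (by linarith) ?_
    have : (0 : ℝ) ≤ finrank ℝ V := Nat.cast_nonneg _
    linarith

/-- A smooth compactly supported function has increments of size at most a constant times
`min 1 ‖h‖`. -/
theorem exists_norm_add_sub_le {F : Type*} [NormedAddCommGroup F] [NormedSpace ℝ F] {f : V → F}
    (hf : ContDiff ℝ ∞ f) (hc : HasCompactSupport f) :
    ∃ C : ℝ, 0 ≤ C ∧ ∀ x h : V, ‖f (x + h) - f x‖ ≤ C * min 1 ‖h‖ := by
  obtain ⟨L, hL⟩ := ContDiff.lipschitzWith_of_hasCompactSupport hc hf (by simp)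
  obtain ⟨M, hM⟩ := hf.continuous.bounded_above_of_compact_support hc
  have hM0 : 0 ≤ M := (norm_nonneg _).trans (hM 0)
  refine ⟨max L (2 * M), by positivity, fun x h => ?_⟩
  rcases le_total 1 ‖h‖ with h1 | h1
  · rw [min_eq_left h1, mul_one]
    refine le_trans ?_ (le_max_right _ _)
    linarith [norm_sub_le (f (x + h)) (f x), hM x, hM (x + h)]
  · rw [min_eq_right h1]
    have := hL.dist_le_mul (x + h) x
    rw [dist_eq_norm, dist_eq_norm, add_sub_cancel_left] at this
    exact this.trans (by gcongr; exact le_max_left _ _)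

theorem norm_div_rpow_le_singularMajorant {α : ℝ} {C c : ℝ} (b h : V)
    (hc : |c| ≤ C * min 1 ‖h‖) :
    |c * inner ℝ b h / ‖h‖ ^ ((finrank ℝ V : ℝ) + α + 1)| ≤ C * ‖b‖ * singularMajorant α h := by
  rcases eq_or_ne h 0 with rfl | hh
  · simp [singularMajorant]
  have h0 : 0 < ‖h‖ := norm_pos_iff.2 hh
  rw [abs_div, abs_mul, abs_of_pos (Real.rpow_pos_of_pos h0 _), div_le_iff₀ (by positivity),
    singularMajorant]
  have : ‖h‖ ^ (-((finrank ℝ V : ℝ) + α)) * ‖h‖ ^ ((finrank ℝ V : ℝ) + α + 1) = ‖h‖ := by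
    rw [← Real.rpow_add h0]; ring_nf; simp
  calc |c| * |inner ℝ b h| ≤ (C * min 1 ‖h‖) * (‖b‖ * ‖h‖) := by
        gcongr
        · exact (abs_nonneg _).trans hc
        · exact abs_real_inner_le_norm b h
    _ = C * ‖b‖ * min 1 ‖h‖ * ‖h‖ := by ring
    _ = C * ‖b‖ * min 1 ‖h‖ * (‖h‖ ^ (-((finrank ℝ V : ℝ) + α)) *
        ‖h‖ ^ ((finrank ℝ V : ℝ) + α + 1)) := by rw [this]
    _ = _ := by ring

/-- The fractional derivative of order `α` of `f` at `x` in the direction `b`, without its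
normalising constant. -/
noncomputable def fracDirDeriv (α : ℝ) (f : V → ℝ) (b x : V) : ℝ :=
  ∫ h, (f (x + h) - f x) * inner ℝ b h / ‖h‖ ^ ((finrank ℝ V : ℝ) + α + 1)

theorem integrable_fracDirDeriv [Nontrivial V] {α : ℝ} (hα₀ : 0 < α) (hα₁ : α < 1) {f : V → ℝ}
    (hf : ContDiff ℝ ∞ f) (hc : HasCompactSupport f) (b x : V) :
    Integrable fun h => (f (x + h) - f x) * inner ℝ b h /
      ‖h‖ ^ ((finrank ℝ V : ℝ) + α + 1) := by
  obtain ⟨C, hC0, hC⟩ := exists_norm_add_sub_le hf hc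
  have hcont := hf.continuous
  refine ((integrable_singularMajorant (V := V) hα₀ hα₁).const_mul (C * ‖b‖)).mono'
    (by
      have : Measurable f := hcont.measurable
      exact Measurable.aestronglyMeasurable (by fun_prop)) (ae_of_all _ fun h => ?_)
  exact norm_div_rpow_le_singularMajorant b h (hC x h)

theorem integrable_mul_norm_rpow_neg [Nontrivial V] {s : ℝ} (hs : s < finrank ℝ V) {g : V → ℝ}
    (hg : Continuous g) (hc : HasCompactSupport g) (x : V) :
    Integrable fun h => g (x + h) * ‖h‖ ^ (-s) := by
  obtain ⟨M, hM⟩ := hg.bounded_above_of_compact_support hc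
  obtain ⟨R, hR⟩ := hc.isCompact.isBounded.subset_ball (0 : V)
  have hi := ((integrable_indicator_iff measurableSet_ball).2
    (integrableOn_ball_norm_rpow_neg hs (R + ‖x‖))).const_mul M
  have hgm := hg.measurable
  refine hi.mono' (Measurable.aestronglyMeasurable (by fun_prop)) (ae_of_all _ fun h => ?_)
  rw [norm_mul, Real.norm_of_nonneg (by positivity : (0 : ℝ) ≤ ‖h‖ ^ (-s))]
  by_cases hh : h ∈ Metric.ball (0 : V) (R + ‖x‖)
  · rw [Set.indicator_of_mem hh]; gcongr; exact hM _
  · have : g (x + h) = 0 := by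
      refine image_eq_zero_of_notMem_tsupport fun hx => hh ?_
      have h1 := hR hx
      rw [mem_ball_zero_iff] at h1 ⊢
      have := norm_sub_le (x + h) x
      rw [add_sub_cancel_left] at this
      linarith
    rw [Set.indicator_of_notMem hh, this]; simp

theorem hasFDerivAt_add_norm_sq_rpow {δ : ℝ} (hδ : 0 < δ) (p : ℝ) (h : V) :
    HasFDerivAt (fun h : V => (δ + ‖h‖ ^ 2) ^ p)
      ((p * (δ + ‖h‖ ^ 2) ^ (p - 1)) • (2 • innerSL ℝ h)) h := by
  have h1 : HasFDerivAt (fun h : V => δ + ‖h‖ ^ 2) (2 • innerSL ℝ h) h :=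
    ((hasStrictFDerivAt_norm_sq h).hasFDerivAt).const_add δ
  exact h1.rpow_const (Or.inl (by positivity))

/-- The integrand decays like `‖h‖^(1 - 2p)`. Integrability on the whole space is needed because the
increment `f (x + h) - f x` is not compactly supported in `h`: its constant part is integrated
separately. -/
theorem integrable_inner_mul_add_norm_sq_rpow {δ : ℝ} (hδ₀ : 0 < δ) (hδ₁ : δ ≤ 1) {p : ℝ}
    (hp : (finrank ℝ V : ℝ) < 2 * p - 1) (b : V) :
    Integrable fun h : V => inner ℝ b h * (δ + ‖h‖ ^ 2) ^ (-p) := by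
  have hd : (0 : ℝ) ≤ finrank ℝ V := Nat.cast_nonneg _
  have hi := (integrable_rpow_neg_one_add_norm_sq (E := V) (μ := volume) hp).const_mul
    (‖b‖ * δ ^ (-(2 * p - 1) / 2))
  refine hi.mono' (Measurable.aestronglyMeasurable (by fun_prop)) (ae_of_all _ fun h => ?_)
  have h0 : 0 < δ + ‖h‖ ^ 2 := by positivity
  rw [norm_mul, Real.norm_of_nonneg (Real.rpow_nonneg h0.le _)]
  have h1 : ‖h‖ ≤ (δ + ‖h‖ ^ 2) ^ (1 / 2 : ℝ) := by
    rw [← Real.sqrt_eq_rpow]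
    exact Real.le_sqrt_of_sq_le (by linarith)
  calc ‖inner ℝ b h‖ * (δ + ‖h‖ ^ 2) ^ (-p)
      ≤ (‖b‖ * (δ + ‖h‖ ^ 2) ^ (1 / 2 : ℝ)) * (δ + ‖h‖ ^ 2) ^ (-p) := by
        gcongr
        exact (norm_inner_le_norm b h).trans (by gcongr)
    _ = ‖b‖ * (δ + ‖h‖ ^ 2) ^ (-(2 * p - 1) / 2) := by
        rw [mul_assoc, ← Real.rpow_add h0]; congr 2; ring
    _ ≤ ‖b‖ * (δ * (1 + ‖h‖ ^ 2)) ^ (-(2 * p - 1) / 2) := by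
        gcongr ‖b‖ * ?_
        refine Real.rpow_le_rpow_of_nonpos (by positivity) ?_ (by linarith)
        nlinarith [sq_nonneg ‖h‖]
    _ = _ := by rw [Real.mul_rpow hδ₀.le (by positivity), mul_assoc]

open Filter Topology in
theorem tendsto_add_norm_sq_rpow {h : V} (hh : h ≠ 0) (p : ℝ) :
    Tendsto (fun δ : ℝ => (δ + ‖h‖ ^ 2) ^ (-p)) (𝓝[>] 0) (𝓝 (‖h‖ ^ (-(2 * p)))) := by
  have h0 : 0 < ‖h‖ := norm_pos_iff.2 hh
  have h1 : ‖h‖ ^ (-(2 * p)) = (0 + ‖h‖ ^ 2) ^ (-p) := by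
    rw [zero_add, ← Real.rpow_natCast, ← Real.rpow_mul h0.le]; congr 1; push_cast; ring
  rw [h1]
  refine Tendsto.mono_left ?_ nhdsWithin_le_nhds
  refine Tendsto.rpow_const ?_ (Or.inl (by positivity))
  exact tendsto_id.add_const _

theorem add_norm_sq_rpow_le {h : V} (hh : h ≠ 0) {p δ : ℝ} (hp : 0 ≤ p) (hδ : 0 < δ) :
    (δ + ‖h‖ ^ 2) ^ (-p) ≤ ‖h‖ ^ (-(2 * p)) := by
  have h0 : 0 < ‖h‖ := norm_pos_iff.2 hh
  have h1 : ‖h‖ ^ (-(2 * p)) = (‖h‖ ^ 2) ^ (-p) := by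
    rw [← Real.rpow_natCast, ← Real.rpow_mul h0.le]; congr 1; push_cast; ring
  rw [h1]
  exact Real.rpow_le_rpow_of_nonpos (by positivity) (by linarith) (by linarith)

/-- Integration by parts against the regularised Riesz kernel. -/
theorem integral_sub_mul_add_norm_sq_rpow {δ : ℝ} (hδ₀ : 0 < δ) (hδ₁ : δ ≤ 1) {p : ℝ}
    (hp : (finrank ℝ V : ℝ) < 2 * p + 1) {f : V → ℝ}
    (hf : ContDiff ℝ ∞ f) (hc : HasCompactSupport f) (b x : V) :
    2 * p * ∫ h, (f (x + h) - f x) * (inner ℝ b h * (δ + ‖h‖ ^ 2) ^ (-(p + 1))) =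
      ∫ h, fderiv ℝ f (x + h) b * (δ + ‖h‖ ^ 2) ^ (-p) := by
  have hdf : Continuous (fun y => fderiv ℝ f y b) :=
    (hf.continuous_fderiv (by simp)).clm_apply continuous_const
  have hcd : HasCompactSupport (fun y => fderiv ℝ f y b) := hc.fderiv_apply (𝕜 := ℝ) b
  have hpos : ∀ h : V, 0 < δ + ‖h‖ ^ 2 := fun h => by positivity
  have hk : ∀ q : ℝ, Continuous fun h : V => (δ + ‖h‖ ^ 2) ^ q := fun q =>
    Continuous.rpow_const (by fun_prop) fun h => Or.inl (hpos h).ne'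
  have hkd : ∀ h : V, fderiv ℝ (fun h : V => (δ + ‖h‖ ^ 2) ^ (-p)) h b =
      -(2 * p) * (inner ℝ b h * (δ + ‖h‖ ^ 2) ^ (-(p + 1))) := fun h => by
    rw [(hasFDerivAt_add_norm_sq_rpow hδ₀ (-p) h).fderiv]
    simp only [smul_apply, innerSL_apply_apply, smul_eq_mul, nsmul_eq_mul]
    rw [real_inner_comm, show -p - 1 = -(p + 1) by ring]
    push_cast; ring
  have hshift : ∀ g : V → ℝ, HasCompactSupport g → HasCompactSupport fun h => g (x + h) :=
    fun g hg => hg.comp_homeomorph (Homeomorph.addLeft x)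
  have hinn : Continuous fun h : V => inner ℝ b h * (δ + ‖h‖ ^ 2) ^ (-(p + 1)) :=
    (by fun_prop : Continuous fun h : V => inner ℝ b h).mul (hk _)
  have hfx : ∀ h, fderiv ℝ (fun h => f (x + h)) h b = fderiv ℝ f (x + h) b := fun h => by
    rw [fderiv_comp_add_left]
  have hfc : Continuous fun h => f (x + h) := hf.continuous.comp (by fun_prop)
  have hdfc : Continuous fun h => fderiv ℝ f (x + h) b := hdf.comp (by fun_prop)
  have hibp := integral_mul_fderiv_eq_neg_fderiv_mul_of_integrable (𝕜 := ℝ) (μ := (volume : Measure V))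
    (f := fun h => f (x + h)) (g := fun h : V => (δ + ‖h‖ ^ 2) ^ (-p)) (v := b)
    (by
      simp_rw [hfx]
      exact (hdfc.mul (hk _)).integrable_of_hasCompactSupport ((hshift _ hcd).mul_right))
    (by
      simp_rw [hkd]
      exact (hfc.mul (continuous_const.mul hinn)).integrable_of_hasCompactSupport
        ((hshift _ hc).mul_right))
    ((hfc.mul (hk _)).integrable_of_hasCompactSupport ((hshift _ hc).mul_right))
    (fun h _ => ((hf.differentiable (by simp)).comp (by fun_prop : Differentiable ℝ (x + ·))) h)
    (fun h _ => (hasFDerivAt_add_norm_sq_rpow hδ₀ (-p) h).differentiableAt)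
  simp_rw [hfx, hkd] at hibp
  -- The regularised kernel is odd, so subtracting `f x` does not change the integral.
  have hodd : ∫ h : V, inner ℝ b h * (δ + ‖h‖ ^ 2) ^ (-(p + 1)) = 0 := by
    have h := integral_neg_eq_self (fun h : V => inner ℝ b h * (δ + ‖h‖ ^ 2) ^ (-(p + 1))) volume
    simp only [inner_neg_right, norm_neg, neg_mul, integral_neg] at h
    linarith
  have hint := integrable_inner_mul_add_norm_sq_rpow (V := V) hδ₀ hδ₁ (p := p + 1)
    (by linarith) b
  have hsplit : ∫ h, (f (x + h) - f x) * (inner ℝ b h * (δ + ‖h‖ ^ 2) ^ (-(p + 1))) =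
      ∫ h, f (x + h) * (inner ℝ b h * (δ + ‖h‖ ^ 2) ^ (-(p + 1))) := by
    simp_rw [sub_mul]
    have h1 : Integrable fun h => f (x + h) * (inner ℝ b h * (δ + ‖h‖ ^ 2) ^ (-(p + 1))) :=
      (hfc.mul hinn).integrable_of_hasCompactSupport ((hshift _ hc).mul_right)
    rw [integral_sub h1 (hint.const_mul _), integral_const_mul, hodd, mul_zero, sub_zero]
  rw [hsplit, ← neg_inj, ← hibp, ← neg_mul, ← integral_const_mul]
  congr 1; ext h; ring

open Filter Topology in
/-- The fractional derivative is the Riesz potential of the classical derivative. -/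
theorem fracDirDeriv_eq_integral_fderiv [Nontrivial V] {α : ℝ} (hα₀ : 0 < α) (hα₁ : α < 1)
    {f : V → ℝ} (hf : ContDiff ℝ ∞ f) (hc : HasCompactSupport f) (b x : V) :
    ((finrank ℝ V : ℝ) + α - 1) * fracDirDeriv α f b x =
      ∫ h, fderiv ℝ f (x + h) b * ‖h‖ ^ (-((finrank ℝ V : ℝ) + α - 1)) := by
  have hd : (1 : ℝ) ≤ finrank ℝ V := by exact_mod_cast Module.finrank_pos
  set β := (finrank ℝ V : ℝ) + α - 1 with hβ
  have hdf : Continuous (fun y => fderiv ℝ f y b) :=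
    (hf.continuous_fderiv (by simp)).clm_apply continuous_const
  have hcd : HasCompactSupport (fun y => fderiv ℝ f y b) := hc.fderiv_apply (𝕜 := ℝ) b
  have hfm := hf.continuous.measurable
  have hdfm := hdf.measurable
  have hne : ∀ᵐ h : V, h ≠ 0 := by simp [ae_iff]
  have heq : ∀ h : V, (f (x + h) - f x) * inner ℝ b h / ‖h‖ ^ ((finrank ℝ V : ℝ) + α + 1) =
      (f (x + h) - f x) * (inner ℝ b h * ‖h‖ ^ (-(2 * (β / 2 + 1)))) := fun h => by
    rw [Real.rpow_neg (norm_nonneg h), div_eq_mul_inv, mul_assoc]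
    congr 4; rw [hβ]; ring
  have hI := integrable_fracDirDeriv hα₀ hα₁ hf hc b x
  -- Integration by parts is not available directly at the singularity, so both sides are limits as
  -- `δ → 0⁺` of the regularised identity with `p = β / 2`. The unregularised integrands dominate.
  have hL : Tendsto (fun δ : ℝ => 2 * (β / 2) *
      ∫ h, (f (x + h) - f x) * (inner ℝ b h * (δ + ‖h‖ ^ 2) ^ (-(β / 2 + 1)))) (𝓝[>] 0)
      (𝓝 (2 * (β / 2) * fracDirDeriv α f b x)) := by
    refine Tendsto.const_mul _ ?_
    rw [fracDirDeriv]
    simp_rw [heq] at hI ⊢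
    refine tendsto_integral_filter_of_dominated_convergence
      (fun h => ‖(f (x + h) - f x) * (inner ℝ b h * ‖h‖ ^ (-(2 * (β / 2 + 1))))‖)
      (Eventually.of_forall fun δ => Measurable.aestronglyMeasurable (by fun_prop)) ?_ hI.norm ?_
    · filter_upwards [self_mem_nhdsWithin] with δ hδ
      filter_upwards [hne] with h hh
      rw [norm_mul, norm_mul, norm_mul, norm_mul]
      gcongr
      have := add_norm_sq_rpow_le hh (p := β / 2 + 1) (by linarith) hδ
      rw [Real.norm_of_nonneg (Real.rpow_nonneg (add_nonneg (le_of_lt hδ) (by positivity)) _)]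
      exact this.trans (le_abs_self _)
    · filter_upwards [hne] with h hh
      exact ((tendsto_add_norm_sq_rpow hh _).const_mul _).const_mul _
  have hR : Tendsto (fun δ : ℝ => ∫ h, fderiv ℝ f (x + h) b * (δ + ‖h‖ ^ 2) ^ (-(β / 2)))
      (𝓝[>] 0) (𝓝 (∫ h, fderiv ℝ f (x + h) b * ‖h‖ ^ (-(2 * (β / 2))))) := by
    have hI2 := integrable_mul_norm_rpow_neg (s := 2 * (β / 2)) (by linarith) hdf hcd x
    refine tendsto_integral_filter_of_dominated_convergence
      (fun h => ‖fderiv ℝ f (x + h) b * ‖h‖ ^ (-(2 * (β / 2)))‖)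
      (Eventually.of_forall fun δ => Measurable.aestronglyMeasurable (by fun_prop)) ?_ hI2.norm ?_
    · filter_upwards [self_mem_nhdsWithin] with δ hδ
      filter_upwards [hne] with h hh
      rw [norm_mul, norm_mul]
      gcongr
      have := add_norm_sq_rpow_le hh (p := β / 2) (by linarith) hδ
      rw [Real.norm_of_nonneg (Real.rpow_nonneg (add_nonneg (le_of_lt hδ) (by positivity)) _)]
      exact this.trans (le_abs_self _)
    · filter_upwards [hne] with h hh
      exact (tendsto_add_norm_sq_rpow hh _).const_mul _
  have hev : (fun δ : ℝ => 2 * (β / 2) *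
      ∫ h, (f (x + h) - f x) * (inner ℝ b h * (δ + ‖h‖ ^ 2) ^ (-(β / 2 + 1)))) =ᶠ[𝓝[>] 0]
      fun δ : ℝ => ∫ h, fderiv ℝ f (x + h) b * (δ + ‖h‖ ^ 2) ^ (-(β / 2)) := by
    filter_upwards [Ioo_mem_nhdsGT (zero_lt_one' ℝ)] with δ hδ
    exact integral_sub_mul_add_norm_sq_rpow hδ.1 hδ.2.le (by linarith) hf hc b x
  have := tendsto_nhds_unique (hL.congr' hev) hR
  rwa [show 2 * (β / 2) = β by ring] at this

end Kernels

end FracBV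

namespace FracBV

/-! ### The radial profile: Riesz potential of the annulus field. -/

section Profile

variable {V : Type*} [NormedAddCommGroup V] [InnerProductSpace ℝ V] [FiniteDimensional ℝ V]
  [MeasurableSpace V] [BorelSpace V]

open Module

/-- The field `z ↦ z`, cut off to the annulus `1 ≤ ‖z‖ ≤ 2`. -/
noncomputable def annulusField (z : V) : V :=
  {z : V | 1 ≤ ‖z‖ ∧ ‖z‖ ≤ 2}.indicator id z

theorem measurableSet_annulus : MeasurableSet {z : V | 1 ≤ ‖z‖ ∧ ‖z‖ ≤ 2} :=
  (measurableSet_le measurable_const measurable_norm).inter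
    (measurableSet_le measurable_norm measurable_const)

theorem measurable_annulusField : Measurable (annulusField : V → V) :=
  measurable_id.indicator measurableSet_annulus

theorem annulusField_eq_self {z : V} (h1 : 1 ≤ ‖z‖) (h2 : ‖z‖ ≤ 2) : annulusField z = z :=
  Set.indicator_of_mem (s := {z : V | 1 ≤ ‖z‖ ∧ ‖z‖ ≤ 2}) ⟨h1, h2⟩ _

theorem annulusField_eq_zero {z : V} (h : ¬(1 ≤ ‖z‖ ∧ ‖z‖ ≤ 2)) : annulusField z = 0 :=
  Set.indicator_of_notMem (s := {z : V | 1 ≤ ‖z‖ ∧ ‖z‖ ≤ 2}) h _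

theorem annulusField_isometry (R : V ≃ₗᵢ[ℝ] V) (z : V) :
    annulusField (R z) = R (annulusField z) := by
  by_cases h : 1 ≤ ‖z‖ ∧ ‖z‖ ≤ 2
  · rw [annulusField_eq_self h.1 h.2, annulusField_eq_self] <;> simp [h.1, h.2]
  · rw [annulusField_eq_zero h, annulusField_eq_zero (by simpa using h), map_zero]

theorem annulusField_neg (z : V) : annulusField (-z) = -annulusField z :=
  annulusField_isometry (LinearIsometryEquiv.neg ℝ) z

theorem norm_annulusField_le (z : V) :
    ‖annulusField z‖ ≤ (Metric.ball (0 : V) 3).indicator (fun _ => 2) z := by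
  by_cases h : 1 ≤ ‖z‖ ∧ ‖z‖ ≤ 2
  · rw [annulusField_eq_self h.1 h.2, Set.indicator_of_mem (by simp; linarith)]
    exact h.2
  · rw [annulusField_eq_zero h, norm_zero]
    exact Set.indicator_nonneg (fun _ _ => by norm_num) _

theorem integrable_annulusField : Integrable (annulusField : V → V) := by
  refine (((integrable_indicator_iff measurableSet_ball).2 (integrableOn_const
    (C := (2 : ℝ)) (measure_ball_lt_top (x := (0 : V)) (r := 3)).ne))).mono'
    measurable_annulusField.aestronglyMeasurable (ae_of_all _ norm_annulusField_le)

/-- The Riesz-type potential with kernel `‖·‖ ^ (-s)` of the annulus field. -/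
noncomputable def rieszField (s : ℝ) (v : V) : V :=
  ∫ z, ‖v - z‖ ^ (-s) • annulusField z

/-- The radial coefficient of `rieszField`. -/
noncomputable def rieszProfile (s : ℝ) (v : V) : ℝ :=
  inner ℝ v (rieszField s v) / ‖v‖ ^ 2

theorem norm_rieszField_integrand_le (s : ℝ) (v z : V) :
    ‖‖v - z‖ ^ (-s) • annulusField z‖ ≤
      2 * (Metric.ball (0 : V) 3).indicator (fun z => ‖v - z‖ ^ (-s)) z := by
  rw [norm_smul, Real.norm_of_nonneg (by positivity)]
  refine (mul_le_mul_of_nonneg_left (norm_annulusField_le z) (by positivity)).trans (le_of_eq ?_)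
  by_cases h : z ∈ Metric.ball (0 : V) 3
  · rw [Set.indicator_of_mem h, Set.indicator_of_mem h, mul_comm]
  · rw [Set.indicator_of_notMem h, Set.indicator_of_notMem h]; ring

theorem integrable_rieszField_integrand [Nontrivial V] {s : ℝ} (hs₀ : 0 ≤ s)
    (hs : s < finrank ℝ V) (v : V) :
    Integrable fun z => ‖v - z‖ ^ (-s) • annulusField z := by
  obtain ⟨C, -, hC⟩ := exists_integral_ball_norm_sub_rpow_neg_le (V := V) hs₀ hs 3
  refine (((integrable_indicator_iff measurableSet_ball).2 (hC v).1).const_mul 2).mono'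
    (Measurable.aestronglyMeasurable ?_) (ae_of_all _ (norm_rieszField_integrand_le s v))
  have := measurable_annulusField (V := V)
  fun_prop

theorem exists_norm_rieszField_le [Nontrivial V] {s : ℝ} (hs₀ : 0 ≤ s)
    (hs : s < finrank ℝ V) :
    ∃ C : ℝ, 0 ≤ C ∧ ∀ v : V, ∫ z, ‖‖v - z‖ ^ (-s) • annulusField z‖ ≤ C := by
  obtain ⟨C, hC0, hC⟩ := exists_integral_ball_norm_sub_rpow_neg_le (V := V) hs₀ hs 3
  refine ⟨2 * C, by positivity, fun v => ?_⟩
  calc ∫ z, ‖‖v - z‖ ^ (-s) • annulusField z‖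
      ≤ ∫ z, 2 * (Metric.ball (0 : V) 3).indicator (fun z => ‖v - z‖ ^ (-s)) z :=
        integral_mono (integrable_rieszField_integrand hs₀ hs v).norm
          (((integrable_indicator_iff measurableSet_ball).2 (hC v).1).const_mul 2)
          (norm_rieszField_integrand_le s v)
    _ ≤ 2 * C := by
        rw [integral_const_mul, integral_indicator measurableSet_ball]
        exact mul_le_mul_of_nonneg_left (hC v).2 (by norm_num)

theorem stronglyMeasurable_rieszField (s : ℝ) :
    StronglyMeasurable (rieszField s : V → V) := by
  have h : StronglyMeasurable fun p : V × V => ‖p.1 - p.2‖ ^ (-s) • annulusField p.2 := by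
    have := measurable_annulusField (V := V)
    exact Measurable.stronglyMeasurable (by fun_prop)
  exact h.integral_prod_right'

theorem measurable_rieszProfile (s : ℝ) : Measurable (rieszProfile s : V → ℝ) := by
  have := (stronglyMeasurable_rieszField (V := V) s).measurable
  unfold rieszProfile
  fun_prop

/-- The kernel depends only on distances and the annulus field commutes with linear isometries. -/
theorem rieszField_isometry (s : ℝ) (R : V ≃ₗᵢ[ℝ] V) (v : V) :
    rieszField s (R v) = R (rieszField s v) := by
  have h := R.measurePreserving.integral_comp R.toHomeomorph.measurableEmbedding
    (fun z => ‖R v - z‖ ^ (-s) • annulusField z)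
  rw [rieszField, ← h, rieszField]
  simp_rw [annulusField_isometry, ← map_sub, R.norm_map, ← map_smul]
  exact (R.toContinuousLinearEquiv.integral_comp_comm _)

/-- The reflection across the line `ℝ v` fixes `v`, hence by equivariance fixes the field at `v`;
its fixed vectors are exactly those on the line. -/
theorem rieszField_eq_smul (s : ℝ) (v : V) : rieszField s v = rieszProfile s v • v := by
  set K : Submodule ℝ V := Submodule.span ℝ {v}
  have hv : K.reflection v = v :=
    (Submodule.reflection_eq_self_iff v).2 (Submodule.mem_span_singleton_self v)
  have hW : K.reflection (rieszField s v) = rieszField s v := by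
    rw [← rieszField_isometry, hv]
  obtain ⟨c, hc⟩ := Submodule.mem_span_singleton.1 ((Submodule.reflection_eq_self_iff _).1 hW)
  rcases eq_or_ne v 0 with rfl | h0
  · rw [smul_zero, ← hc, smul_zero]
  rw [rieszProfile, ← hc, inner_smul_right, real_inner_self_eq_norm_sq,
    mul_div_assoc, div_self (by positivity), mul_one]

theorem norm_rieszField_eq (s : ℝ) (v : V) : ‖rieszField s v‖ = |rieszProfile s v| * ‖v‖ := by
  rw [rieszField_eq_smul, norm_smul, Real.norm_eq_abs]

/-- Averages over `z` and `-z`, using that the annulus field is odd. This form shows both the linear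
vanishing at the origin and the sign of the profile. -/
theorem rieszField_eq_half_integral_sub [Nontrivial V] {s : ℝ} (hs₀ : 0 ≤ s)
    (hs : s < finrank ℝ V) (v : V) :
    (Integrable fun z => (‖v - z‖ ^ (-s) - ‖v + z‖ ^ (-s)) • annulusField z) ∧
    rieszField s v = (1 / 2 : ℝ) •
      ∫ z, (‖v - z‖ ^ (-s) - ‖v + z‖ ^ (-s)) • annulusField z := by
  have hi := integrable_rieszField_integrand hs₀ hs v
  have hi' : Integrable fun z => ‖v + z‖ ^ (-s) • annulusField z := by
    have := hi.comp_neg.neg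
    refine this.congr (ae_of_all _ fun z => ?_)
    simp [annulusField_neg]
  have h' : ∫ z, ‖v + z‖ ^ (-s) • annulusField z = -rieszField s v := by
    rw [rieszField, ← integral_neg_eq_self, ← integral_neg]
    simp [annulusField_neg, sub_eq_add_neg]
  simp_rw [sub_smul]
  refine ⟨hi.sub hi', ?_⟩
  rw [integral_sub hi hi', h', sub_neg_eq_add]
  change _ = (1 / 2 : ℝ) • (rieszField s v + rieszField s v)
  rw [← two_smul ℝ, smul_smul]
  norm_num

theorem abs_rpow_neg_sub_rpow_neg_le {s c a b : ℝ} (hs : 0 ≤ s) (hc : 0 < c) (ha : c ≤ a)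
    (hb : c ≤ b) : |a ^ (-s) - b ^ (-s)| ≤ s * c ^ (-s - 1) * |a - b| := by
  refine Convex.norm_image_sub_le_of_norm_hasDerivWithin_le (s := Set.Ici c)
    (f := fun x : ℝ => x ^ (-s)) (f' := fun x => -s * x ^ (-s - 1))
    (fun x hx => (Real.hasDerivAt_rpow_const (Or.inl (hc.trans_le hx).ne')).hasDerivWithinAt)
    (fun x hx => ?_) (convex_Ici c) hb ha
  have hx0 : 0 < x := hc.trans_le hx
  rw [norm_mul, norm_neg, Real.norm_of_nonneg hs, Real.norm_of_nonneg (by positivity)]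
  exact mul_le_mul_of_nonneg_left (Real.rpow_le_rpow_of_nonpos hc hx (by linarith)) hs

/-- For `z` in the annulus both `v - z` and `v + z` have norm at least `1/2`, where the kernel is
Lipschitz, and their norms differ by at most `2 ‖v‖`. The factor `‖v‖` compensates the division by
`‖v‖` in the profile. -/
theorem norm_rieszField_le_of_norm_le_half [Nontrivial V] {s : ℝ} (hs₀ : 0 ≤ s)
    (hs : s < finrank ℝ V) {v : V} (hv : ‖v‖ ≤ 1 / 2) :
    ‖rieszField s v‖ ≤ s * (1 / 2 : ℝ) ^ (-s - 1) * (∫ z : V, ‖annulusField z‖) * ‖v‖ := by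
  obtain ⟨hi, he⟩ := rieszField_eq_half_integral_sub hs₀ hs v
  have key : ∀ z : V, ‖(‖v - z‖ ^ (-s) - ‖v + z‖ ^ (-s)) • annulusField z‖ ≤
      (2 * (s * (1 / 2 : ℝ) ^ (-s - 1) * ‖v‖)) * ‖annulusField z‖ := fun z => by
    by_cases h : 1 ≤ ‖z‖ ∧ ‖z‖ ≤ 2
    · rw [norm_smul]
      gcongr
      have h1 : 1 / 2 ≤ ‖v - z‖ := by
        have := norm_sub_norm_le z v; rw [norm_sub_rev] at this; linarith [h.1]
      have h2 : 1 / 2 ≤ ‖v + z‖ := by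
        have := norm_sub_norm_le z (-v); rw [sub_neg_eq_add, add_comm, norm_neg] at this
        linarith [h.1]
      refine (abs_rpow_neg_sub_rpow_neg_le hs₀ (by norm_num) h1 h2).trans ?_
      have h3 : |‖v - z‖ - ‖v + z‖| ≤ 2 * ‖v‖ := by
        have h4 : |‖z - v‖ - ‖v + z‖| ≤ ‖(z - v) - (v + z)‖ := abs_norm_sub_norm_le _ _
        rw [norm_sub_rev, show (z - v) - (v + z) = (-2 : ℝ) • v by rw [neg_smul, two_smul]; abel,
          norm_smul] at h4
        simpa using h4
      calc _ ≤ s * (1 / 2 : ℝ) ^ (-s - 1) * (2 * ‖v‖) := by gcongr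
        _ = _ := by ring
    · rw [annulusField_eq_zero h]; simp
  rw [he, norm_smul]
  calc ‖(1 / 2 : ℝ)‖ * ‖∫ z, (‖v - z‖ ^ (-s) - ‖v + z‖ ^ (-s)) • annulusField z‖
      ≤ (1 / 2) * ∫ z, (2 * (s * (1 / 2 : ℝ) ^ (-s - 1) * ‖v‖)) * ‖annulusField z‖ := by
        rw [Real.norm_of_nonneg (by norm_num : (0 : ℝ) ≤ 1 / 2)]
        gcongr
        exact norm_integral_le_of_norm_le (integrable_annulusField.norm.const_mul _)
          (ae_of_all _ key)
    _ = _ := by rw [integral_const_mul]; ring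

theorem norm_rieszField_le_of_four_le_norm [Nontrivial V] {s : ℝ} (hs₀ : 0 ≤ s) {v : V}
    (hv : 4 ≤ ‖v‖) :
    ‖rieszField s v‖ ≤ (‖v‖ / 2) ^ (-s) * ∫ z : V, ‖annulusField z‖ := by
  rw [rieszField, ← integral_const_mul]
  refine norm_integral_le_of_norm_le (integrable_annulusField.norm.const_mul _)
    (ae_of_all _ fun z => ?_)
  by_cases h : 1 ≤ ‖z‖ ∧ ‖z‖ ≤ 2
  · rw [norm_smul, Real.norm_of_nonneg (by positivity)]
    gcongr ?_ * _
    refine Real.rpow_le_rpow_of_nonpos (by linarith) ?_ (by linarith)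
    linarith [norm_sub_norm_le v z, h.2]
  · rw [annulusField_eq_zero h]; simp

/-- The radial coefficient of the Riesz field decays like `‖v‖ ^ (-(s + 1))`. -/
theorem exists_abs_rieszProfile_le [Nontrivial V] {s : ℝ} (hs₀ : 0 ≤ s)
    (hs : s < finrank ℝ V) :
    ∃ C : ℝ, 0 ≤ C ∧ ∀ v : V, |rieszProfile s v| ≤ C * (1 + ‖v‖) ^ (-(s + 1)) := by
  obtain ⟨C₁, hC₁, hb⟩ := exists_norm_rieszField_le (V := V) hs₀ hs
  set J := ∫ z : V, ‖annulusField z‖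
  have hJ : 0 ≤ J := integral_nonneg fun z => norm_nonneg _
  set C₂ := s * (1 / 2 : ℝ) ^ (-s - 1) * J
  have hC₂ : 0 ≤ C₂ := by positivity
  set C₃ := (2 : ℝ) ^ s * J
  have hC₃ : 0 ≤ C₃ := by positivity
  -- `C₂` serves `‖v‖ ≤ 1/2` and `2 C₁` serves `1/2 ≤ ‖v‖ ≤ 4`; there `1 + ‖v‖ ≤ 5`. `C₃` serves
  -- `‖v‖ ≥ 4`, where `‖v‖ ≥ (1 + ‖v‖) / 2`.
  refine ⟨(C₂ + 2 * C₁) * 5 ^ (s + 1) + C₃ * 2 ^ (s + 1), by positivity, fun v => ?_⟩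
  rcases eq_or_ne v 0 with rfl | h0
  · simp [rieszProfile]; positivity
  have hv0 : 0 < ‖v‖ := norm_pos_iff.2 h0
  have hP : |rieszProfile s v| = ‖rieszField s v‖ / ‖v‖ := by
    rw [norm_rieszField_eq, mul_div_assoc, div_self hv0.ne', mul_one]
  have hpow : 0 ≤ (1 + ‖v‖) ^ (-(s + 1)) := by positivity
  rw [hP]
  rcases le_total ‖v‖ 4 with h4 | h4
  · have h5 : 1 ≤ (5 : ℝ) ^ (s + 1) * (1 + ‖v‖) ^ (-(s + 1)) := by
      have : (1 + ‖v‖) ^ (s + 1) ≤ (5 : ℝ) ^ (s + 1) := by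
        gcongr; linarith
      rw [Real.rpow_neg (by positivity), ← div_eq_mul_inv, one_le_div (by positivity)]
      exact this
    have h6 : ‖rieszField s v‖ / ‖v‖ ≤ C₂ + 2 * C₁ := by
      rw [div_le_iff₀ hv0]
      rcases le_total ‖v‖ (1 / 2) with h | h
      · have := norm_rieszField_le_of_norm_le_half hs₀ hs h
        nlinarith [mul_nonneg hC₁ hv0.le]
      · have := (norm_integral_le_integral_norm (fun z => ‖v - z‖ ^ (-s) • annulusField z)).trans
          (hb v)
        change ‖rieszField s v‖ ≤ C₁ at this
        nlinarith [mul_nonneg hC₂ hv0.le, mul_le_mul_of_nonneg_left h hC₁]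
    calc ‖rieszField s v‖ / ‖v‖ ≤ (C₂ + 2 * C₁) * 1 := by linarith
      _ ≤ (C₂ + 2 * C₁) * ((5 : ℝ) ^ (s + 1) * (1 + ‖v‖) ^ (-(s + 1))) := by gcongr
      _ ≤ _ := by nlinarith [mul_nonneg (mul_nonneg hC₃ (by positivity : (0:ℝ) ≤ 2 ^ (s + 1))) hpow]
  · have h7 := norm_rieszField_le_of_four_le_norm hs₀ h4
    have h8 : (‖v‖ / 2) ^ (-s) / ‖v‖ ≤ 2 ^ s * (2 ^ (s + 1) * (1 + ‖v‖) ^ (-(s + 1))) := by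
      have e1 : (‖v‖ / 2) ^ (-s) / ‖v‖ = 2 ^ s * ‖v‖ ^ (-(s + 1)) := by
        rw [Real.div_rpow hv0.le (by norm_num), Real.rpow_neg (by norm_num : (0:ℝ) ≤ 2),
          div_inv_eq_mul, neg_add, Real.rpow_add hv0, Real.rpow_neg_one]
        ring
      have e2 : (2 : ℝ) ^ (s + 1) * (1 + ‖v‖) ^ (-(s + 1)) = ((1 + ‖v‖) / 2) ^ (-(s + 1)) := by
        rw [Real.div_rpow (by positivity) (by norm_num), Real.rpow_neg (by norm_num : (0:ℝ) ≤ 2),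
          div_inv_eq_mul, mul_comm]
      rw [e1, e2]
      gcongr ?_ * ?_
      exact Real.rpow_le_rpow_of_nonpos (by positivity) (by linarith) (by linarith)
    calc ‖rieszField s v‖ / ‖v‖ ≤ ((‖v‖ / 2) ^ (-s) * J) / ‖v‖ := by gcongr
      _ = J * ((‖v‖ / 2) ^ (-s) / ‖v‖) := by ring
      _ ≤ J * (2 ^ s * (2 ^ (s + 1) * (1 + ‖v‖) ^ (-(s + 1)))) := by gcongr
      _ = C₃ * 2 ^ (s + 1) * (1 + ‖v‖) ^ (-(s + 1)) := by ring
      _ ≤ _ := by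
        rw [add_mul]
        exact le_add_of_nonneg_left (by positivity)

theorem integrable_rieszProfile [Nontrivial V] {s : ℝ} (hs₀ : 0 ≤ s)
    (hs : s < finrank ℝ V) (hs' : (finrank ℝ V : ℝ) < s + 1) :
    Integrable (rieszProfile s : V → ℝ) := by
  obtain ⟨C, -, hC⟩ := exists_abs_rieszProfile_le (V := V) hs₀ hs
  exact ((integrable_one_add_norm hs').const_mul C).mono'
    (measurable_rieszProfile s).aestronglyMeasurable (ae_of_all _ hC)

theorem norm_sub_lt_norm_add_iff (v z : V) :
    ‖v - z‖ < ‖v + z‖ ↔ 0 < (inner ℝ v z : ℝ) := by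
  rw [← sq_lt_sq₀ (norm_nonneg (v - z)) (norm_nonneg (v + z)), norm_sub_sq_real,
    norm_add_sq_real]
  constructor <;> intro h <;> linarith

/-- In the antisymmetrised integral the kernel difference and `inner ℝ v z` have the same sign,
because `z` is closer to `v` than to `-v` exactly when this inner product is positive. -/
theorem rieszProfile_pos [Nontrivial V] {s : ℝ} (hs₀ : 0 < s)
    (hs : s < finrank ℝ V) {v : V} (hv : v ≠ 0) : 0 < rieszProfile s v := by
  obtain ⟨hi, he⟩ := rieszField_eq_half_integral_sub hs₀.le hs v
  have hv0 : 0 < ‖v‖ := norm_pos_iff.2 hv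
  refine div_pos ?_ (by positivity)
  rw [he, inner_smul_right, ← integral_inner hi]
  refine mul_pos (by norm_num) ?_
  simp_rw [inner_smul_right]
  have hi' : Integrable fun z : V =>
      (‖v - z‖ ^ (-s) - ‖v + z‖ ^ (-s)) * inner ℝ v (annulusField z) := by
    simpa only [inner_smul_right] using hi.const_inner (𝕜 := ℝ) v
  have hlt : ∀ z : V, z ≠ v → 0 < (inner ℝ v z : ℝ) → 0 < ‖v - z‖ ^ (-s) - ‖v + z‖ ^ (-s) := by
    intro z hz h
    rw [sub_pos]
    exact Real.rpow_lt_rpow_of_neg (norm_pos_iff.2 (sub_ne_zero.2 hz.symm))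
      ((norm_sub_lt_norm_add_iff v z).2 h) (by linarith)
  have hnn : 0 ≤ᵐ[volume] fun z =>
      (‖v - z‖ ^ (-s) - ‖v + z‖ ^ (-s)) * inner ℝ v (annulusField z) := by
    -- The points `z = ±v` are excluded: there a real power `0 ^ (-s)` takes the value `0` instead
    -- of `∞` and the sign argument fails.
    have h1 : ∀ᵐ z : V, z ≠ v := by simp [ae_iff]
    have h2 : ∀ᵐ z : V, z ≠ -v := by simp [ae_iff]
    filter_upwards [h1, h2] with z hz1 hz2
    simp only [Pi.zero_apply]
    by_cases h : 1 ≤ ‖z‖ ∧ ‖z‖ ≤ 2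
    · rw [annulusField_eq_self h.1 h.2]
      rcases lt_trichotomy (inner ℝ v z : ℝ) 0 with h0 | h0 | h0
      · have := hlt (-z) (fun h => hz2 (by rw [← h, neg_neg])) (by rw [inner_neg_right]; linarith)
        rw [sub_neg_eq_add, ← sub_eq_add_neg] at this
        nlinarith
      · rw [h0, mul_zero]
      · exact (mul_pos (hlt z hz1 h0) h0).le
    · rw [annulusField_eq_zero h]; simp
  rw [integral_pos_iff_support_of_nonneg_ae hnn hi']
  set U : Set V := {z | (1 < ‖z‖ ∧ ‖z‖ < 2) ∧ 0 < (inner ℝ v z : ℝ)} with hU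
  have hUo : IsOpen U :=
    ((isOpen_lt continuous_const continuous_norm).inter
      (isOpen_lt continuous_norm continuous_const)).inter
      (isOpen_lt continuous_const (f := fun _ => 0) (g := fun z => inner ℝ v z)
        (continuous_const.inner continuous_id))
  have hUn : U.Nonempty := by
    refine ⟨(3 / 2 * ‖v‖⁻¹) • v, ?_⟩
    have : ‖(3 / 2 * ‖v‖⁻¹) • v‖ = 3 / 2 := by
      rw [norm_smul, norm_mul, norm_inv, norm_norm, mul_assoc, inv_mul_cancel₀ hv0.ne']
      norm_num
    refine ⟨by rw [this]; norm_num, ?_⟩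
    rw [inner_smul_right, real_inner_self_eq_norm_sq]
    positivity
  have hpos : 0 < volume (U \ {v}) := by
    rw [measure_sdiff_null (by simp)]
    exact hUo.measure_pos volume hUn
  refine hpos.trans_le (measure_mono fun z hz => ?_)
  rw [Function.mem_support, annulusField_eq_self hz.1.1.1.le hz.1.1.2.le]
  exact (mul_pos (hlt z hz.2 hz.1.2) hz.1.2).ne'

theorem integral_rieszProfile_pos [Nontrivial V] {s : ℝ} (hs₀ : 0 < s)
    (hs : s < finrank ℝ V) (hs' : (finrank ℝ V : ℝ) < s + 1) :
    0 < ∫ v : V, rieszProfile s v := by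
  have hne : ∀ᵐ v : V, v ≠ 0 := by simp [ae_iff]
  rw [integral_pos_iff_support_of_nonneg_ae
    (by filter_upwards [hne] with v hv using (rieszProfile_pos hs₀ hs hv).le)
    (integrable_rieszProfile hs₀.le hs hs')]
  have h : 0 < volume ({0}ᶜ : Set V) := by
    refine isOpen_compl_singleton.measure_pos volume ?_
    obtain ⟨v, hv⟩ := exists_ne (0 : V)
    exact ⟨v, hv⟩
  exact h.trans_le (measure_mono fun v hv => (rieszProfile_pos hs₀ hs hv).ne')

end Profile

end FracBV

namespace FracBV

/-! ### Smoothness and fractional divergence of superpositions of translates. -/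

section Superposition

universe u

variable {V : Type u} [NormedAddCommGroup V] [InnerProductSpace ℝ V] [FiniteDimensional ℝ V]
  [MeasurableSpace V] [BorelSpace V] {X : Type*} [MeasurableSpace X] {ν : Measure X}
  {a : X → V} {G : X → V}

open Module

theorem aestronglyMeasurable_smul_comp_sub {F : Type*} [NormedAddCommGroup F] [NormedSpace ℝ F]
    {f : V → F} (hf : Continuous f) (hc : HasCompactSupport f) (ha : Measurable a) {c : X → ℝ}
    (hG : AEStronglyMeasurable c ν) (x : V) :
    AEStronglyMeasurable (fun p => c p • f (x - a p)) ν :=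
  hG.smul ((hf.stronglyMeasurable_of_hasCompactSupport hc).comp_measurable
      (measurable_const.sub ha)).aestronglyMeasurable

theorem hasFDerivAt_integral_smul_comp_sub {F : Type*} [NormedAddCommGroup F] [NormedSpace ℝ F]
    {f : V → F} (hf : ContDiff ℝ ∞ f)
    (hc : HasCompactSupport f) (ha : Measurable a) {c : X → ℝ} (hG : Integrable c ν) (x : V) :
    HasFDerivAt (fun x => ∫ p, c p • f (x - a p) ∂ν)
      (∫ p, c p • fderiv ℝ f (x - a p) ∂ν) x := by
  obtain ⟨M, hM⟩ := hf.continuous.bounded_above_of_compact_support hc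
  have hdf : Continuous (fderiv ℝ f) := hf.continuous_fderiv (by simp)
  obtain ⟨M', hM'⟩ := hdf.bounded_above_of_compact_support (hc.fderiv (𝕜 := ℝ))
  have hm := aestronglyMeasurable_smul_comp_sub hf.continuous hc ha hG.aestronglyMeasurable
  have hm' := aestronglyMeasurable_smul_comp_sub hdf (hc.fderiv (𝕜 := ℝ)) ha
    hG.aestronglyMeasurable x
  have hi : Integrable (fun p => c p • f (x - a p)) ν :=
    (hG.norm.mul_const M).mono' (hm x) (ae_of_all _ fun p => by
      rw [norm_smul]; gcongr; exact hM _)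
  refine hasFDerivAt_integral_of_dominated_of_fderiv_le
    (F := fun x p => c p • f (x - a p))
    (F' := fun x p => c p • fderiv ℝ f (x - a p)) (bound := fun p => ‖c p‖ * M')
    Filter.univ_mem (Filter.Eventually.of_forall hm) hi hm'
    (ae_of_all _ fun p y _ => ?_) (hG.norm.mul_const _) (ae_of_all _ fun p y _ => ?_)
  · rw [norm_smul]; gcongr; exact hM' _
  · have h1 : HasFDerivAt (fun x => f (x - a p)) (fderiv ℝ f (y - a p)) y :=
      (hasFDerivAt_comp_sub (a p)).2 ((hf.differentiable (by simp)) (y - a p)).hasFDerivAt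
    exact h1.const_smul (c p)

/-- All derivatives fall on `f`. The induction passes from `F` to `V →L[ℝ] F`, so `F` is quantified
after `k` and shares the universe of `V`. -/
theorem contDiff_nat_integral_smul_comp_sub (ha : Measurable a) {c : X → ℝ}
    (hG : Integrable c ν) (k : ℕ) :
    ∀ {F : Type u} [NormedAddCommGroup F] [NormedSpace ℝ F] {f : V → F},
      ContDiff ℝ ∞ f → HasCompactSupport f →
      ContDiff ℝ k (fun x => ∫ p, c p • f (x - a p) ∂ν) := by
  induction k with
  | zero =>
    intro F _ _ f hf hc
    rw [Nat.cast_zero, contDiff_zero]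
    exact continuous_iff_continuousAt.2 fun x =>
      (hasFDerivAt_integral_smul_comp_sub hf hc ha hG x).continuousAt
  | succ k ih =>
    intro F _ _ f hf hc
    rw [Nat.cast_add, Nat.cast_one, contDiff_succ_iff_hasFDerivAt]
    refine ⟨fun x => ∫ p, c p • fderiv ℝ f (x - a p) ∂ν, ih (hf.fderiv_right (m := ∞) le_rfl)
      (hc.fderiv (𝕜 := ℝ)), fun x => hasFDerivAt_integral_smul_comp_sub hf hc ha hG x⟩

theorem integrable_comp_sub_smul (ha : Measurable a) (hG : Integrable G ν) {f : V → ℝ}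
    (hf : ContDiff ℝ ∞ f) (hc : HasCompactSupport f) (x : V) :
    Integrable (fun p => f (x - a p) • G p) ν := by
  obtain ⟨M, hM⟩ := hf.continuous.bounded_above_of_compact_support hc
  refine hG.bdd_smul M ?_ (ae_of_all _ fun p => hM _)
  exact (hf.continuous.measurable.comp (measurable_const.sub ha)).aestronglyMeasurable

/-- A superposition of translates of a smooth compactly supported function is smooth. -/
theorem contDiff_integral_comp_sub_smul (ha : Measurable a) (hG : Integrable G ν) {f : V → ℝ}
    (hf : ContDiff ℝ ∞ f) (hc : HasCompactSupport f) :
    ContDiff ℝ ∞ (fun x => ∫ p, f (x - a p) • G p ∂ν) := by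
  let e := stdOrthonormalBasis ℝ V
  -- Coordinates turn the vector weight into scalar weights times fixed vectors, the form treated by
  -- the induction on the order of smoothness.
  have key : (fun x => ∫ p, f (x - a p) • G p ∂ν) =
      fun x => ∑ i, ∫ p, inner ℝ (e i) (G p) • (f (x - a p) • e i) ∂ν := by
    ext x
    rw [← integral_finsetSum]
    · congr 1; ext p
      conv_lhs => rw [← e.sum_repr' (G p), Finset.smul_sum]
      exact Finset.sum_congr rfl fun i _ => smul_comm _ _ _
    · intro i _
      have h := (integrable_comp_sub_smul ha hG hf hc x).const_inner (𝕜 := ℝ) (e i)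
      refine (h.smul_const (e i)).congr (ae_of_all _ fun p => ?_)
      simp only [inner_smul_right, smul_smul, mul_comm]
  rw [key, contDiff_infty]
  intro k
  refine ContDiff.sum fun i _ => ?_
  exact contDiff_nat_integral_smul_comp_sub ha (hG.const_inner (e i)) k
    (hf.smul contDiff_const) hc.smul_right

/-- The fractional divergence of a superposition of translates. -/
theorem integral_inner_superposition [Nontrivial V] [SFinite ν] {α : ℝ} (hα₀ : 0 < α)
    (hα₁ : α < 1) (ha : Measurable a) (hG : Integrable G ν) {f : V → ℝ}
    (hf : ContDiff ℝ ∞ f) (hc : HasCompactSupport f) (x : V) :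
    Integrable (fun p => fracDirDeriv α f (G p) (x - a p)) ν ∧
    ∫ h, inner ℝ ((∫ p, f (x + h - a p) • G p ∂ν) - ∫ p, f (x - a p) • G p ∂ν) h /
      ‖h‖ ^ ((finrank ℝ V : ℝ) + α + 1) = ∫ p, fracDirDeriv α f (G p) (x - a p) ∂ν := by
  obtain ⟨C, hC0, hC⟩ := exists_norm_add_sub_le hf hc
  have hfm := hf.continuous.measurable
  have hint : Integrable (fun q : V × X => (f (x - a q.2 + q.1) - f (x - a q.2)) *
      inner ℝ (G q.2) q.1 / ‖q.1‖ ^ ((finrank ℝ V : ℝ) + α + 1)) (volume.prod ν) := by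
    have h1 := ((integrable_singularMajorant (V := V) hα₀ hα₁).mul_prod
      (hG.norm.const_mul C))
    refine h1.mono' ?_ (ae_of_all _ fun q => ?_)
    · have hGs : AEStronglyMeasurable (fun q : V × X => G q.2) (volume.prod ν) :=
        hG.aestronglyMeasurable.comp_snd
      have e1 : AEStronglyMeasurable (fun q : V × X => (f (x - a q.2 + q.1) - f (x - a q.2)))
          (volume.prod ν) := Measurable.aestronglyMeasurable (by fun_prop)
      have e2 : AEStronglyMeasurable (fun q : V × X => (‖q.1‖ ^ ((finrank ℝ V : ℝ) + α + 1))⁻¹)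
          (volume.prod ν) := Measurable.aestronglyMeasurable (by fun_prop)
      simp_rw [div_eq_mul_inv]
      exact (e1.mul (hGs.inner measurable_fst.aestronglyMeasurable)).mul e2
    · refine (norm_div_rpow_le_singularMajorant (G q.2) q.1 (hC (x - a q.2) q.1)).trans (le_of_eq ?_)
      ring
  have hswap := integral_integral_swap (μ := volume) (ν := ν)
    (f := fun (h : V) (p : X) => (f (x - a p + h) - f (x - a p)) *
      inner ℝ (G p) h / ‖h‖ ^ ((finrank ℝ V : ℝ) + α + 1)) hint
  refine ⟨hint.integral_prod_right, ?_⟩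
  simp only [fracDirDeriv]
  rw [← hswap]
  congr 1; ext h
  have i1 := integrable_comp_sub_smul ha hG hf hc (x + h)
  have i2 := integrable_comp_sub_smul ha hG hf hc x
  have i3 := integral_inner (𝕜 := ℝ) (i1.sub i2) h
  simp only [Pi.sub_apply] at i3
  rw [← integral_sub i1 i2, real_inner_comm, ← i3, ← integral_div]
  congr 1; ext p
  rw [← sub_smul, inner_smul_right, real_inner_comm, add_sub_right_comm]

end Superposition

/-! ### The field whose fractional divergence nearly reproduces `f`. -/

section PotentialField

universe u

variable {V : Type u} [NormedAddCommGroup V] [InnerProductSpace ℝ V] [FiniteDimensional ℝ V]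
  [MeasurableSpace V] [BorelSpace V]

open Module Set

/-- The vector weight in the definition of `potentialField`. -/
noncomputable def potentialWeight (α : ℝ) (p : ℝ × V) : V := p.1 ^ (α - 1) • annulusField p.2

/-- The superposition over scales `t ∈ (0, T]` of mollifications of `f` by dilates of
`annulusField`, whose fractional divergence is a multiple of `f` up to an error at scale `T`. -/
noncomputable def potentialField (α T : ℝ) (f : V → ℝ) (x : V) : V :=
  ∫ p, f (x - p.1 • p.2) • potentialWeight α p ∂(volume.restrict (Ioc 0 T)).prod volume

theorem integrableOn_Ioc_rpow {s : ℝ} (hs : -1 < s) {T : ℝ} (hT : 0 ≤ T) :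
    IntegrableOn (fun t : ℝ => t ^ s) (Ioc 0 T) := by
  have := intervalIntegral.intervalIntegrable_rpow' (a := 0) (b := T) hs
  rwa [intervalIntegrable_iff_integrableOn_Ioc_of_le hT] at this

theorem integrable_potentialWeight {α : ℝ} (hα₀ : 0 < α) {T : ℝ} (hT : 0 ≤ T) :
    Integrable (potentialWeight α : ℝ × V → V)
      ((volume.restrict (Ioc 0 T)).prod volume) :=
  (integrableOn_Ioc_rpow (by linarith) hT).smul_prod integrable_annulusField

theorem measurable_smul_fst_snd : Measurable fun p : ℝ × V => p.1 • p.2 := by fun_prop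

theorem contDiff_potentialField {α : ℝ} (hα₀ : 0 < α) {T : ℝ} (hT : 0 ≤ T) {f : V → ℝ}
    (hf : ContDiff ℝ ∞ f) (hc : HasCompactSupport f) : ContDiff ℝ ∞ (potentialField α T f) :=
  contDiff_integral_comp_sub_smul measurable_smul_fst_snd (integrable_potentialWeight hα₀ hT) hf hc

theorem norm_potentialField_le {α : ℝ} (hα₀ : 0 < α) {T : ℝ} (hT : 0 ≤ T) {f : V → ℝ}
    {M : ℝ} (hM : ∀ x, |f x| ≤ M) (x : V) :
    ‖potentialField α T f x‖ ≤
      M * ∫ p : ℝ × V, ‖potentialWeight α p‖ ∂(volume.restrict (Ioc 0 T)).prod volume := by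
  rw [← integral_const_mul]
  refine norm_integral_le_of_norm_le ((integrable_potentialWeight hα₀ hT).norm.const_mul M)
    (ae_of_all _ fun p => ?_)
  rw [norm_smul]
  gcongr
  exact hM _

theorem potentialField_eq_zero {α T R : ℝ} {f : V → ℝ}
    (hR : ∀ x, R < ‖x‖ → f x = 0) {x : V} (hx : R + 2 * T < ‖x‖) :
    potentialField α T f x = 0 := by
  refine integral_eq_zero_of_ae ?_
  have h : ∀ᵐ p : ℝ × V ∂(volume.restrict (Ioc 0 T)).prod volume, p.1 ∈ Ioc 0 T :=
    Measure.quasiMeasurePreserving_fst.ae (ae_restrict_mem measurableSet_Ioc)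
  filter_upwards [h] with p hp
  by_cases hz : 1 ≤ ‖p.2‖ ∧ ‖p.2‖ ≤ 2
  · have : f (x - p.1 • p.2) = 0 := by
      refine hR _ ?_
      have h1 : ‖p.1 • p.2‖ ≤ T * 2 := by
        rw [norm_smul, Real.norm_of_nonneg hp.1.le]
        exact mul_le_mul hp.2 hz.2 (norm_nonneg _) (hp.1.le.trans hp.2)
      linarith [norm_sub_norm_le x (p.1 • p.2)]
    simp [this]
  · simp [potentialWeight, annulusField_eq_zero hz]

theorem hasCompactSupport_potentialField {α T : ℝ} {f : V → ℝ} (hc : HasCompactSupport f) :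
    HasCompactSupport (potentialField α T f) := by
  obtain ⟨R, hR⟩ := hc.isCompact.isBounded.subset_closedBall (0 : V)
  refine HasCompactSupport.intro (isCompact_closedBall (0 : V) (R + 2 * T)) fun x hx => ?_
  refine potentialField_eq_zero (R := R) (fun y hy => ?_) (by simpa using hx)
  exact image_eq_zero_of_notMem_tsupport fun h => by
    have := hR h
    rw [mem_closedBall_zero_iff] at this
    linarith

/-- Substitute `h = t (z - y)`. The weight `t^(α - 1)` is chosen so that it cancels the Jacobian and
the homogeneity of the kernel, leaving no power of `t`. -/
theorem integral_fderiv_add_mul_norm_rpow_dilate {α t : ℝ} (ht : 0 < t) (f : V → ℝ) (x z b : V) :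
    ∫ h, fderiv ℝ f (x - t • z + h) (t ^ (α - 1) • b) * ‖h‖ ^ (-((finrank ℝ V : ℝ) + α - 1)) =
      ∫ y, fderiv ℝ f (x - t • y) b * ‖y - z‖ ^ (-((finrank ℝ V : ℝ) + α - 1)) := by
  set β := (finrank ℝ V : ℝ) + α - 1 with hβ
  set g : V → ℝ := fun h => fderiv ℝ f (x - t • z + h) (t ^ (α - 1) • b) * ‖h‖ ^ (-β) with hg
  have h1 := Measure.integral_comp_smul volume g t
  have h2 := integral_sub_left_eq_self (fun y => g (t • y)) volume z
  rw [h1] at h2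
  have ht' : (0 : ℝ) < t ^ finrank ℝ V := by positivity
  rw [abs_of_pos (inv_pos.2 ht'), smul_eq_mul] at h2
  have h3 : ∫ h, g h = t ^ finrank ℝ V * ∫ y, g (t • (z - y)) := by
    rw [h2, ← mul_assoc, mul_inv_cancel₀ ht'.ne', one_mul]
  rw [h3, ← integral_const_mul]
  congr 1; ext y
  simp only [hg]
  have e1 : x - t • z + t • (z - y) = x - t • y := by rw [smul_sub]; abel
  rw [e1, norm_smul, Real.norm_of_nonneg ht.le, norm_sub_rev, Real.mul_rpow ht.le (norm_nonneg _),
    map_smul, smul_eq_mul]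
  have e2 : t ^ finrank ℝ V * (t ^ (α - 1) * t ^ (-β)) = 1 := by
    rw [← Real.rpow_natCast, ← Real.rpow_add ht, ← Real.rpow_add ht, hβ]
    ring_nf; simp
  calc _ = (t ^ finrank ℝ V * (t ^ (α - 1) * t ^ (-β))) *
        (fderiv ℝ f (x - t • y) b * ‖y - z‖ ^ (-β)) := by ring
    _ = _ := by rw [e2, one_mul]

/-- By Fubini the `z`-integral assembles the Riesz field at `y`, which points along `y`; hence the
derivative of `f` becomes a derivative along the ray through `y`. -/
theorem integral_integral_fderiv_annulusField [Nontrivial V] {s : ℝ} (hs₀ : 0 ≤ s)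
    (hs : s < finrank ℝ V) {f : V → ℝ} (hf : ContDiff ℝ ∞ f) (hc : HasCompactSupport f)
    {t : ℝ} (ht : 0 < t) (x : V) :
    ∫ z, ∫ y, fderiv ℝ f (x - t • y) (annulusField z) * ‖y - z‖ ^ (-s) =
      ∫ y, rieszProfile s y * fderiv ℝ f (x - t • y) y := by
  have hdf : Continuous (fderiv ℝ f) := hf.continuous_fderiv (by simp)
  have hcd : HasCompactSupport (fun y => fderiv ℝ f (x - t • y)) := by
    have e : (fun y : V => fderiv ℝ f (x - t • y)) = fderiv ℝ f ∘
        ((Homeomorph.smulOfNeZero t ht.ne').trans (Homeomorph.subLeft x)) := rfl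
    rw [e]
    exact (hc.fderiv (𝕜 := ℝ)).comp_homeomorph _
  have hcont : Continuous (fun y => fderiv ℝ f (x - t • y)) := hdf.comp (by fun_prop)
  have hdi : Integrable (fun y => fderiv ℝ f (x - t • y)) :=
    hcont.integrable_of_hasCompactSupport hcd
  obtain ⟨C, hC0, hC⟩ := exists_norm_rieszField_le (V := V) hs₀ hs
  have hψ := measurable_annulusField (V := V)
  have hWm : Measurable fun q : V × V => ‖q.1 - q.2‖ ^ (-s) • annulusField q.2 := by fun_prop
  have hmeas : AEStronglyMeasurable (fun q : V × V => fderiv ℝ f (x - t • q.1)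
      (‖q.1 - q.2‖ ^ (-s) • annulusField q.2)) (volume.prod volume) :=
    (ContinuousLinearMap.apply ℝ ℝ : V →L[ℝ] (V →L[ℝ] ℝ) →L[ℝ] ℝ).aestronglyMeasurable_comp₂
      hWm.aestronglyMeasurable
      ((hcont.measurable.comp measurable_fst).aestronglyMeasurable)
  have hint : Integrable (fun q : V × V => fderiv ℝ f (x - t • q.1)
      (‖q.1 - q.2‖ ^ (-s) • annulusField q.2)) (volume.prod volume) := by
    rw [integrable_prod_iff hmeas]
    have hW := fun y : V => integrable_rieszField_integrand hs₀ hs y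
    refine ⟨ae_of_all _ fun y => (fderiv ℝ f (x - t • y)).integrable_comp (hW y), ?_⟩
    refine (hdi.norm.mul_const C).mono' hmeas.norm.integral_prod_right' (ae_of_all _ fun y => ?_)
    rw [Real.norm_of_nonneg (integral_nonneg fun z => norm_nonneg _)]
    calc _ ≤ ∫ z, ‖fderiv ℝ f (x - t • y)‖ * ‖‖y - z‖ ^ (-s) • annulusField z‖ :=
          integral_mono ((fderiv ℝ f (x - t • y)).integrable_comp (hW y)).norm
            ((hW y).norm.const_mul _) fun z => ContinuousLinearMap.le_opNorm _ _
      _ ≤ _ := by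
          rw [integral_const_mul]
          gcongr
          exact hC y
  have hswap := integral_integral_swap (μ := (volume : Measure V)) (ν := (volume : Measure V))
    (f := fun y z => fderiv ℝ f (x - t • y) (‖y - z‖ ^ (-s) • annulusField z)) hint
  calc ∫ z, ∫ y, fderiv ℝ f (x - t • y) (annulusField z) * ‖y - z‖ ^ (-s)
      = ∫ z, ∫ y, fderiv ℝ f (x - t • y) (‖y - z‖ ^ (-s) • annulusField z) := by
        simp_rw [map_smul, smul_eq_mul, mul_comm]
    _ = ∫ y, ∫ z, fderiv ℝ f (x - t • y) (‖y - z‖ ^ (-s) • annulusField z) := hswap.symm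
    _ = ∫ y, fderiv ℝ f (x - t • y) (rieszField s y) := by
        congr 1; ext y
        exact (fderiv ℝ f (x - t • y)).integral_comp_comm (integrable_rieszField_integrand hs₀ hs y)
    _ = _ := by simp_rw [rieszField_eq_smul, map_smul, smul_eq_mul]

theorem integral_fderiv_ray {f : V → ℝ} (hf : ContDiff ℝ ∞ f) (x y : V) {T : ℝ} (hT : 0 ≤ T) :
    ∫ t in Ioc 0 T, fderiv ℝ f (x - t • y) y = f x - f (x - T • y) := by
  rw [← intervalIntegral.integral_of_le hT]
  have hder : ∀ t ∈ uIcc 0 T, HasDerivAt (fun t : ℝ => -f (x - t • y))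
      (fderiv ℝ f (x - t • y) y) t := fun t _ => by
    have h1 : HasDerivAt (fun t : ℝ => x - t • y) (-y) t := by
      simpa using ((hasDerivAt_id t).smul_const y).const_sub x
    have h2 := ((hf.differentiable (by simp)) (x - t • y)).hasFDerivAt.comp_hasDerivAt t h1
    have h3 := h2.neg
    rw [map_neg, neg_neg] at h3
    exact h3
  rw [intervalIntegral.integral_eq_sub_of_hasDerivAt hder]
  · simp; ring
  · have hdf : Continuous (fderiv ℝ f) := hf.continuous_fderiv (by simp)
    have : Continuous fun t : ℝ => fderiv ℝ f (x - t • y) y :=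
      (hdf.comp (by fun_prop)).clm_apply continuous_const
    exact this.intervalIntegrable _ _

/-- Justifies exchanging the integrals over scales and space. The decay of the profile alone does
not suffice: after the factor `‖y‖` only order `finrank ℝ V + α - 1` would remain. -/
theorem integrable_rieszProfile_mul_fderiv [Nontrivial V] {α : ℝ} (hα₀ : 0 < α) (hα₁ : α < 1)
    {f : V → ℝ} (hf : ContDiff ℝ ∞ f) (hc : HasCompactSupport f) (x : V) {T : ℝ} (hT : 0 ≤ T) :
    Integrable (fun q : ℝ × V => rieszProfile ((finrank ℝ V : ℝ) + α - 1) q.2 *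
      fderiv ℝ f (x - q.1 • q.2) q.2) ((volume.restrict (Ioc 0 T)).prod volume) := by
  have hd : (1 : ℝ) ≤ finrank ℝ V := by exact_mod_cast Module.finrank_pos
  have hdf : Continuous (fderiv ℝ f) := hf.continuous_fderiv (by simp)
  obtain ⟨M, hM⟩ := hdf.bounded_above_of_compact_support (hc.fderiv (𝕜 := ℝ))
  have hM0 : 0 ≤ M := (norm_nonneg _).trans (hM 0)
  obtain ⟨R, hR0, hR⟩ := (hc.fderiv (𝕜 := ℝ)).isCompact.isBounded.subset_closedBall_lt 0 x
  obtain ⟨C, hC0, hC⟩ := exists_abs_rieszProfile_le (V := V)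
    (s := (finrank ℝ V : ℝ) + α - 1) (by linarith) (by linarith)
  have hb := ((integrableOn_Ioc_rpow (s := α / 2 - 1) (by linarith) hT).const_mul
    (C * M * R ^ (1 - α / 2))).mul_prod (integrable_one_add_norm (E := V) (μ := volume)
      (r := (finrank ℝ V : ℝ) + α / 2) (by linarith))
  have hPm := measurable_rieszProfile (V := V) ((finrank ℝ V : ℝ) + α - 1)
  have hcc : Continuous fun q : ℝ × V => fderiv ℝ f (x - q.1 • q.2) q.2 :=
    (hdf.comp (by fun_prop)).clm_apply continuous_snd
  have hccm := hcc.measurable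
  refine hb.mono' (Measurable.aestronglyMeasurable (by fun_prop)) ?_
  have h : ∀ᵐ p : ℝ × V ∂(volume.restrict (Ioc 0 T)).prod volume, p.1 ∈ Ioc 0 T :=
    Measure.quasiMeasurePreserving_fst.ae (ae_restrict_mem measurableSet_Ioc)
  filter_upwards [h] with q hq
  obtain ⟨t, y⟩ := q
  have ht : 0 < t := hq.1
  simp only [norm_mul]
  have hy1 : 0 < 1 + ‖y‖ := by positivity
  -- On the support of the derivative `t ‖y‖ ≤ R`. Splitting `‖y‖ = (t‖y‖)^(1 - α/2) t^(α/2 - 1)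
  -- ‖y‖^(α/2)` spends half of `α` on integrability in `t` near `0` and keeps half for decay in `y`.
  have key : ‖fderiv ℝ f (x - t • y) y‖ ≤
      M * (R ^ (1 - α / 2) * t ^ (α / 2 - 1) * (1 + ‖y‖) ^ (α / 2)) := by
    by_cases hmem : x - t • y ∈ tsupport (fderiv ℝ f)
    · have h1 := hR hmem
      rw [Metric.mem_closedBall, dist_eq_norm, sub_sub_cancel_left, norm_neg, norm_smul,
        Real.norm_of_nonneg ht.le] at h1
      refine (ContinuousLinearMap.le_opNorm _ _).trans ?_
      gcongr
      · exact hM _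
      rcases eq_or_ne y 0 with rfl | hy
      · simp; positivity
      have hy0 : 0 < ‖y‖ := norm_pos_iff.2 hy
      calc ‖y‖ = (t * ‖y‖) ^ (1 - α / 2) * t ^ (α / 2 - 1) * ‖y‖ ^ (α / 2) := by
            rw [Real.mul_rpow ht.le hy0.le]
            have e1 : t ^ (1 - α / 2) * t ^ (α / 2 - 1) = 1 := by
              rw [← Real.rpow_add ht]; ring_nf; simp
            have e2 : ‖y‖ ^ (1 - α / 2) * ‖y‖ ^ (α / 2) = ‖y‖ := by
              rw [← Real.rpow_add hy0]; ring_nf; simp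
            calc ‖y‖ = 1 * ‖y‖ := (one_mul _).symm
              _ = (t ^ (1 - α / 2) * t ^ (α / 2 - 1)) * (‖y‖ ^ (1 - α / 2) * ‖y‖ ^ (α / 2)) := by
                  rw [e1, e2]
              _ = _ := by ring
        _ ≤ _ := by
            gcongr
            · linarith
            · linarith
    · rw [image_eq_zero_of_notMem_tsupport hmem]
      simp only [zero_apply, norm_zero]
      positivity
  calc ‖rieszProfile ((finrank ℝ V : ℝ) + α - 1) y‖ * ‖fderiv ℝ f (x - t • y) y‖
      ≤ (C * (1 + ‖y‖) ^ (-((finrank ℝ V : ℝ) + α - 1 + 1))) *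
        (M * (R ^ (1 - α / 2) * t ^ (α / 2 - 1) * (1 + ‖y‖) ^ (α / 2))) := by
        gcongr
        exact hC y
    _ = (C * M * R ^ (1 - α / 2)) * t ^ (α / 2 - 1) *
        ((1 + ‖y‖) ^ (-((finrank ℝ V : ℝ) + α - 1 + 1)) * (1 + ‖y‖) ^ (α / 2)) := by ring
    _ = _ := by
        rw [← Real.rpow_add hy1]
        congr 2; ring

/-- The fractional divergence of `potentialField` recovers `f` up to an averaging at scale `T`. -/
theorem integral_inner_potentialField [Nontrivial V] {α : ℝ} (hα₀ : 0 < α) (hα₁ : α < 1)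
    {f : V → ℝ} (hf : ContDiff ℝ ∞ f) (hc : HasCompactSupport f) (x : V) {T : ℝ} (hT : 0 ≤ T) :
    ((finrank ℝ V : ℝ) + α - 1) *
      ∫ h, inner ℝ (potentialField α T f (x + h) - potentialField α T f x) h /
        ‖h‖ ^ ((finrank ℝ V : ℝ) + α + 1) =
      ∫ y, rieszProfile ((finrank ℝ V : ℝ) + α - 1) y * (f x - f (x - T • y)) := by
  have hd : (1 : ℝ) ≤ finrank ℝ V := by exact_mod_cast Module.finrank_pos
  set β := (finrank ℝ V : ℝ) + α - 1 with hβ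
  obtain ⟨hi, he⟩ := integral_inner_superposition hα₀ hα₁ (measurable_smul_fst_snd (V := V))
    (integrable_potentialWeight hα₀ hT) hf hc x
  have hQ := integrable_rieszProfile_mul_fderiv hα₀ hα₁ hf hc x hT
  simp only [potentialField]
  rw [he, integral_prod _ hi, ← integral_const_mul]
  calc ∫ t in Ioc 0 T, β * ∫ z, fracDirDeriv α f (potentialWeight α (t, z)) (x - t • z)
      = ∫ t in Ioc 0 T, ∫ y, rieszProfile β y * fderiv ℝ f (x - t • y) y := by
        refine setIntegral_congr_fun measurableSet_Ioc fun t ht => ?_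
        rw [← integral_const_mul,
          ← integral_integral_fderiv_annulusField (by linarith) (by linarith) hf hc ht.1 x]
        congr 1; ext z
        rw [fracDirDeriv_eq_integral_fderiv hα₀ hα₁ hf hc, potentialWeight,
          integral_fderiv_add_mul_norm_rpow_dilate ht.1]
    _ = ∫ y, ∫ t in Ioc 0 T, rieszProfile β y * fderiv ℝ f (x - t • y) y :=
        integral_integral_swap hQ
    _ = _ := by
        congr 1; ext y
        rw [integral_const_mul, integral_fderiv_ray hf x y hT]

end PotentialField

end FracBV

/-! ### The `L¹` estimate by the variation on a large ball. -/

namespace FracBV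

variable {n : ℕ}

theorem gradConst_pos {α : ℝ} (hα₀ : 0 < α) (hα₁ : α < 1) : 0 < gradConst n α := by
  have hn : (0 : ℝ) ≤ n := Nat.cast_nonneg n
  have h1 := Real.Gamma_pos_of_pos (s := ((n : ℝ) + α + 1) / 2) (by linarith)
  have h2 := Real.Gamma_pos_of_pos (s := (1 - α) / 2) (by linarith)
  unfold gradConst
  positivity

theorem fracDiv_eq_integral_add (α : ℝ) (φ : EuclideanSpace ℝ (Fin n) → EuclideanSpace ℝ (Fin n))
    (x : EuclideanSpace ℝ (Fin n)) :
    fracDiv α φ x = gradConst n α * ∫ h, inner ℝ (φ (x + h) - φ x) h /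
      ‖h‖ ^ ((Module.finrank ℝ (EuclideanSpace ℝ (Fin n)) : ℝ) + α + 1) := by
  rw [fracDiv, finrank_euclideanSpace_fin, ← integral_add_left_eq_self _ x]
  simp only [add_sub_cancel_left]

theorem norm_innerPairing_le : ‖innerPairing n‖ ≤ 1 :=
  norm_innerSL_le ℝ

/-- Pairing a bounded field supported in a set against a vector measure is controlled by the
variation of that set. -/
theorem abs_integral_innerPairing_le
    {μ : VectorMeasure (EuclideanSpace ℝ (Fin n)) (EuclideanSpace ℝ (Fin n))}
    (hμ : μ.variation Set.univ < ⊤) {φ : EuclideanSpace ℝ (Fin n) → EuclideanSpace ℝ (Fin n)}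
    {A : ℝ} {S : Set (EuclideanSpace ℝ (Fin n))} (hS : MeasurableSet S)
    (hA : ∀ x, ‖φ x‖ ≤ A) (hφ : ∀ x ∉ S, φ x = 0) :
    |μ.integral φ (innerPairing n)| ≤ A * μ.variation.real S := by
  have : IsFiniteMeasure μ.variation := ⟨hμ⟩
  refine (VectorMeasure.norm_integral_le_integral_norm (μ := μ) (B := innerPairing n)
    (f := φ)).trans ?_
  have h1 : ∫ x, ‖φ x‖ ∂μ.variation ≤ ∫ x, S.indicator (fun _ => A) x ∂μ.variation := by
    refine integral_mono_of_nonneg (ae_of_all _ fun x => norm_nonneg _)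
      ((integrable_const A).indicator hS) (ae_of_all _ fun x => ?_)
    by_cases hx : x ∈ S
    · simpa [hx] using hA x
    · simp [hx, hφ x hx]
  rw [integral_indicator_const _ hS, smul_eq_mul, mul_comm] at h1
  calc _ ≤ 1 * ∫ x, ‖φ x‖ ∂μ.variation := by
        gcongr
        exact norm_innerPairing_le
    _ ≤ _ := by rw [one_mul]; exact h1

/-- The quotient `b / √(b² + δ²)` is a smooth substitute for the sign of `b`, and `b` a smooth
approximation of `a`; the two errors are `δ` and `2 |a - b|`. -/
theorem le_mul_div_sqrt_add_sq {a b δ : ℝ} (hδ : 0 < δ) :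
    |a| - 2 * |a - b| - δ ≤ a * (b / √(b ^ 2 + δ ^ 2)) := by
  set r := √(b ^ 2 + δ ^ 2) with hr
  have hr0 : 0 < r := Real.sqrt_pos.2 (by positivity)
  have hbr : |b| ≤ r := Real.abs_le_sqrt (by nlinarith)
  have hrb : r ≤ |b| + δ := by
    rw [hr, Real.sqrt_le_left (by positivity)]
    nlinarith [sq_abs b, abs_nonneg b]
  have h1 : |b / r| ≤ 1 := by
    rw [abs_div, abs_of_pos hr0]; exact div_le_one_of_le₀ hbr hr0.le
  have h2 : |b| - δ ≤ b * (b / r) := by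
    rw [← mul_div_assoc, le_div_iff₀ hr0]
    nlinarith [sq_abs b, abs_nonneg b]
  have h3 : -|a - b| ≤ (a - b) * (b / r) := by
    have := neg_abs_le ((a - b) * (b / r))
    rw [abs_mul] at this
    nlinarith [abs_nonneg (a - b)]
  have h4 : |a| - |b| ≤ |a - b| := abs_sub_abs_le_abs_sub a b
  calc |a| - 2 * |a - b| - δ ≤ -|a - b| + (|b| - δ) := by linarith
    _ ≤ (a - b) * (b / r) + b * (b / r) := add_le_add h3 h2
    _ = a * (b / r) := by ring

/-- The `L¹` norm of a function vanishing outside of a ball is the supremum of its pairings with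
smooth functions bounded by one and supported in the doubled ball. -/
theorem integral_abs_le_of_forall_contDiff {u : EuclideanSpace ℝ (Fin n) → ℝ}
    (hu : Integrable u) {R : ℝ} (hR : 0 < R)
    (hu0 : ∀ᵐ x, x ∉ Metric.ball (0 : EuclideanSpace ℝ (Fin n)) R → u x = 0) {B : ℝ}
    (hB : ∀ f : EuclideanSpace ℝ (Fin n) → ℝ, ContDiff ℝ ∞ f → HasCompactSupport f →
      (∀ x, |f x| ≤ 1) → (∀ x, 2 * R < ‖x‖ → f x = 0) → ∫ x, u x * f x ≤ B) :
    ∫ x, |u x| ≤ B := by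
  set K := volume.real (Metric.ball (0 : EuclideanSpace ℝ (Fin n)) R)
  have hK : 0 ≤ K := by positivity
  refine le_of_forall_pos_le_add fun ε hε => ?_
  -- The total error is `δ K` from smoothing the sign on the ball plus `2 δ` from approximating `u`
  -- in `L¹`.
  set δ := ε / (K + 2) with hδd
  have hδ : 0 < δ := by positivity
  obtain ⟨g, hgc, hgs, hg⟩ := (memLp_one_iff_integrable.2 hu).exist_eLpNorm_sub_le
    ENNReal.one_ne_top le_rfl hδ
  have hgi : Integrable g := hgs.continuous.integrable_of_hasCompactSupport hgc
  have hug : ∫ x, |u x - g x| ≤ δ := by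
    have h1 := integral_norm_eq_lintegral_enorm (hu.sub hgi).aestronglyMeasurable
    rw [← eLpNorm_one_eq_lintegral_enorm] at h1
    simp only [Pi.sub_apply, Real.norm_eq_abs] at h1
    rw [h1]
    exact ENNReal.toReal_le_of_le_ofReal hδ.le hg
  let χ : ContDiffBump (0 : EuclideanSpace ℝ (Fin n)) := ⟨R, 2 * R, hR, by linarith⟩
  set f : EuclideanSpace ℝ (Fin n) → ℝ := fun x => χ x * (g x / √(g x ^ 2 + δ ^ 2)) with hf
  have hs0 : ∀ x, 0 < g x ^ 2 + δ ^ 2 := fun x => by positivity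
  have hs : ContDiff ℝ ∞ fun x => g x / √(g x ^ 2 + δ ^ 2) :=
    hgs.div (((hgs.pow 2).add contDiff_const).sqrt fun x => (hs0 x).ne')
      fun x => (Real.sqrt_pos.2 (hs0 x)).ne'
  have hfs : ContDiff ℝ ∞ f := χ.contDiff.mul hs
  have hfc : HasCompactSupport f := χ.hasCompactSupport.mul_right
  have hf1 : ∀ x, |f x| ≤ 1 := fun x => by
    have h1 : |g x / √(g x ^ 2 + δ ^ 2)| ≤ 1 := by
      rw [abs_div, abs_of_pos (Real.sqrt_pos.2 (hs0 x))]
      exact div_le_one_of_le₀ (Real.abs_le_sqrt (by nlinarith)) (Real.sqrt_nonneg _)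
    rw [hf, abs_mul, abs_of_nonneg χ.nonneg]
    exact mul_le_one₀ χ.le_one (abs_nonneg _) h1
  have hf0 : ∀ x, 2 * R < ‖x‖ → f x = 0 := fun x hx => by
    have : χ x = 0 := χ.zero_of_le_dist (by rw [dist_zero_right]; exact hx.le)
    simp [hf, this]
  have huf : Integrable fun x => u x * f x :=
    hu.mul_bdd (c := 1) hfs.continuous.aestronglyMeasurable (ae_of_all _ hf1)
  have hind : Integrable ((Metric.ball (0 : EuclideanSpace ℝ (Fin n)) R).indicator
      fun _ => δ) :=
    (integrable_indicator_iff measurableSet_ball).2 (integrableOn_const measure_ball_lt_top.ne)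
  have hle : ∀ᵐ x, |u x| ≤ u x * f x + 2 * |u x - g x| +
      (Metric.ball (0 : EuclideanSpace ℝ (Fin n)) R).indicator (fun _ => δ) x := by
    filter_upwards [hu0] with x hx
    by_cases hxR : x ∈ Metric.ball (0 : EuclideanSpace ℝ (Fin n)) R
    · have : χ x = 1 := χ.one_of_mem_closedBall (Metric.ball_subset_closedBall hxR)
      rw [Set.indicator_of_mem hxR, hf]
      simp only [this, one_mul]
      linarith [le_mul_div_sqrt_add_sq (a := u x) (b := g x) hδ]
    · rw [Set.indicator_of_notMem hxR, hx hxR]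
      simp
  have i2 : Integrable fun x => 2 * |u x - g x| := (hu.sub hgi).abs.const_mul 2
  have i1 : Integrable fun x => u x * f x + 2 * |u x - g x| := huf.add i2
  have hmono := integral_mono_ae hu.abs (i1.add hind) hle
  simp only [Pi.add_apply] at hmono
  rw [integral_add i1 hind, integral_add huf i2, integral_const_mul,
    integral_indicator_const _ measurableSet_ball, smul_eq_mul] at hmono
  have hBf := hB f hfs hfc hf1 hf0
  have : ε = δ * (K + 2) := by rw [hδd]; field_simp
  nlinarith

open Module in
theorem fracDiv_potentialField [Nontrivial (EuclideanSpace ℝ (Fin n))] {α : ℝ} (hα₀ : 0 < α)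
    (hα₁ : α < 1) {f : EuclideanSpace ℝ (Fin n) → ℝ} (hf : ContDiff ℝ ∞ f)
    (hc : HasCompactSupport f) (x : EuclideanSpace ℝ (Fin n)) {T : ℝ} (hT : 0 ≤ T) :
    fracDiv α (potentialField α T f) x = gradConst n α / ((n : ℝ) + α - 1) *
      ((∫ y : EuclideanSpace ℝ (Fin n), rieszProfile ((n : ℝ) + α - 1) y) * f x -
        ∫ y, rieszProfile ((n : ℝ) + α - 1) y * f (x - T • y)) := by
  have hd : (1 : ℝ) ≤ n := by
    have : 0 < finrank ℝ (EuclideanSpace ℝ (Fin n)) := Module.finrank_pos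
    rw [finrank_euclideanSpace_fin] at this
    exact_mod_cast this
  have h := integral_inner_potentialField hα₀ hα₁ hf hc x hT
  have hP : Integrable (rieszProfile ((n : ℝ) + α - 1) : EuclideanSpace ℝ (Fin n) → ℝ) :=
    integrable_rieszProfile (by linarith) (by rw [finrank_euclideanSpace_fin]; linarith)
      (by rw [finrank_euclideanSpace_fin]; linarith)
  obtain ⟨M, hM⟩ := hf.continuous.bounded_above_of_compact_support hc
  have hPf : Integrable fun y => rieszProfile ((n : ℝ) + α - 1) y * f (x - T • y) :=
    hP.mul_bdd (c := M) (hf.continuous.comp (by fun_prop)).aestronglyMeasurable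
      (ae_of_all _ fun y => hM _)
  rw [fracDiv_eq_integral_add, div_mul_eq_mul_div, eq_div_iff (by linarith), mul_assoc, mul_comm _
    ((n : ℝ) + α - 1)]
  simp only [finrank_euclideanSpace_fin] at h ⊢
  rw [h, ← integral_mul_const, ← integral_sub (hP.mul_const _) hPf]
  simp only [mul_sub]

open Module in
/-- The fractional Poincaré inequality with the variation on a large ball. -/
theorem exists_integral_abs_le_variation [Nontrivial (EuclideanSpace ℝ (Fin n))] {α : ℝ}
    (hα₀ : 0 < α) (hα₁ : α < 1) {R : ℝ} (hR : 0 < R) :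
    ∃ R' C : ℝ, 0 ≤ C ∧ ∀ (u : EuclideanSpace ℝ (Fin n) → ℝ)
      (μ : VectorMeasure (EuclideanSpace ℝ (Fin n)) (EuclideanSpace ℝ (Fin n))),
      Integrable u →
      (∀ᵐ x, x ∉ Metric.ball (0 : EuclideanSpace ℝ (Fin n)) R → u x = 0) →
      IsFracVariation α u μ →
      ∫ x, |u x| ≤ C * μ.variation.real (Metric.closedBall 0 R') := by
  have hd' : 0 < finrank ℝ (EuclideanSpace ℝ (Fin n)) := Module.finrank_pos
  have hd : (1 : ℝ) ≤ n := by
    rw [finrank_euclideanSpace_fin] at hd'; exact_mod_cast hd'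
  set β := (n : ℝ) + α - 1 with hβ
  set P : EuclideanSpace ℝ (Fin n) → ℝ := rieszProfile β with hPdef
  have hP : Integrable P :=
    integrable_rieszProfile (by linarith) (by rw [finrank_euclideanSpace_fin]; linarith)
      (by rw [finrank_euclideanSpace_fin]; linarith)
  obtain ⟨CP, hCP0, hCP⟩ := exists_abs_rieszProfile_le (V := EuclideanSpace ℝ (Fin n)) (s := β)
    (by linarith) (by rw [finrank_euclideanSpace_fin]; linarith)
  have hPle : ∀ y, |P y| ≤ CP := fun y => by
    refine (hCP y).trans (mul_le_of_le_one_right hCP0 ?_)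
    exact Real.rpow_le_one_of_one_le_of_nonpos (by linarith [norm_nonneg y]) (by linarith)
  set c := ∫ y, P y with hc
  have hc0 : 0 < c :=
    integral_rieszProfile_pos (by linarith) (by rw [finrank_euclideanSpace_fin]; linarith)
      (by rw [finrank_euclideanSpace_fin]; linarith)
  set κ₁ := volume.real (Metric.ball (0 : EuclideanSpace ℝ (Fin n)) 1) with hκ₁d
  have hκ₁pos : 0 ≤ κ₁ := by positivity
  -- Small enough that the profile, bounded by `CP`, has mass at most `c / 2` on the ball of radius
  -- `r`; the cap at `1` allows `r ^ n ≤ r`.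
  set r := min 1 (c / (2 * (CP * κ₁ + 1))) with hr
  have hr0 : 0 < r := by positivity
  -- For `‖x‖ < R` and `‖y‖ > r` this gives `‖x - T y‖ > 2R`, outside the support of `f`, so only
  -- `‖y‖ ≤ r` contributes to the error term.
  set T := 3 * R / r with hT
  have hT0 : 0 < T := by positivity
  set κ := gradConst n α / β with hκ
  have hκ0 : 0 < κ := div_pos (gradConst_pos hα₀ hα₁) (by linarith)
  set A := 1 * ∫ p : ℝ × EuclideanSpace ℝ (Fin n), ‖potentialWeight α p‖
    ∂(volume.restrict (Set.Ioc 0 T)).prod volume with hA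
  have hA0 : 0 ≤ A := by positivity
  have hsmall : CP * volume.real (Metric.closedBall (0 : EuclideanSpace ℝ (Fin n)) r) ≤ c / 2 := by
    rw [Measure.addHaar_real_closedBall _ _ hr0.le, ← hκ₁d]
    have h1 : r ^ finrank ℝ (EuclideanSpace ℝ (Fin n)) ≤ r :=
      pow_le_of_le_one hr0.le (min_le_left _ _) hd'.ne'
    have h2 : r ≤ c / (2 * (CP * κ₁ + 1)) := min_le_right _ _
    rw [le_div_iff₀ (by positivity)] at h2
    nlinarith [mul_nonneg hCP0 hκ₁pos, mul_le_mul_of_nonneg_left h1 (mul_nonneg hCP0 hκ₁pos)]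
  -- The field built from `f` lives in this ball, since translations by `t z` have length at most
  -- `2T`. `A` bounds its norm uniformly in `f`.
  refine ⟨2 * R + 2 * T, 2 * A / (κ * c), by positivity, fun u μ hu hu0 hμ => ?_⟩
  set W := μ.variation.real (Metric.closedBall 0 (2 * R + 2 * T)) with hW
  set U := ∫ x, |u x| with hU
  -- The term `U / 2` is the averaging error at scale `T`. It is absorbed on the left, which
  -- accounts for the factor `2` in the constant.
  have key : U ≤ A * W / (κ * c) + U / 2 := by
    refine integral_abs_le_of_forall_contDiff hu hR hu0 fun f hf hfc hf1 hf0 => ?_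
    set g : EuclideanSpace ℝ (Fin n) → ℝ := fun x => ∫ y, P y * f (x - T • y) with hg
    have hfm := hf.continuous.measurable
    have hPm : Measurable P := measurable_rieszProfile β
    have hgm : StronglyMeasurable g := by
      have : StronglyMeasurable fun q : EuclideanSpace ℝ (Fin n) × EuclideanSpace ℝ (Fin n) =>
          P q.2 * f (q.1 - T • q.2) := Measurable.stronglyMeasurable (by fun_prop)
      exact this.integral_prod_right'
    have hgle : ∀ x ∈ Metric.ball (0 : EuclideanSpace ℝ (Fin n)) R, |g x| ≤ c / 2 := by
      intro x hx
      rw [mem_ball_zero_iff] at hx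
      refine le_trans ?_ hsmall
      have hle : ∀ y, ‖P y * f (x - T • y)‖ ≤
          (Metric.closedBall (0 : EuclideanSpace ℝ (Fin n)) r).indicator (fun _ => CP) y := by
        intro y
        by_cases hy : y ∈ Metric.closedBall (0 : EuclideanSpace ℝ (Fin n)) r
        · rw [Set.indicator_of_mem hy, norm_mul]
          exact (mul_le_of_le_one_right (norm_nonneg _) (hf1 _)).trans (hPle y)
        · rw [Set.indicator_of_notMem hy]
          rw [mem_closedBall_zero_iff, not_le] at hy
          have : f (x - T • y) = 0 := by
            refine hf0 _ ?_
            have h1 : 3 * R < ‖T • y‖ := by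
              rw [norm_smul, Real.norm_of_nonneg hT0.le, hT, div_mul_eq_mul_div, lt_div_iff₀ hr0]
              exact mul_lt_mul_of_pos_left hy (by positivity)
            have h2 := norm_sub_norm_le (T • y) x
            rw [norm_sub_rev] at h2
            linarith
          simp [this]
      have hi : Integrable ((Metric.closedBall (0 : EuclideanSpace ℝ (Fin n)) r).indicator
          (fun _ => CP)) :=
        (integrable_indicator_iff measurableSet_closedBall).2
          (integrableOn_const measure_closedBall_lt_top.ne)
      have := norm_integral_le_of_norm_le hi (ae_of_all _ hle)
      rwa [integral_indicator_const _ measurableSet_closedBall, smul_eq_mul, mul_comm] at this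
    have hgb : ∀ x, ‖g x‖ ≤ ∫ y, |P y| := fun x =>
      norm_integral_le_of_norm_le hP.abs (ae_of_all _ fun y => by
        rw [norm_mul]; exact mul_le_of_le_one_right (norm_nonneg _) (hf1 _))
    have huf : Integrable fun x => u x * f x :=
      hu.mul_bdd (c := 1) hf.continuous.aestronglyMeasurable (ae_of_all _ hf1)
    have hug : Integrable fun x => u x * g x :=
      hu.mul_bdd hgm.aestronglyMeasurable (ae_of_all _ hgb)
    have hφ : IsTestField (potentialField α T f) :=
      ⟨contDiff_potentialField hα₀ hT0.le hf hfc, hasCompactSupport_potentialField hfc⟩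
    have hdiv : ∫ x, u x * fracDiv α (potentialField α T f) x =
        κ * (c * (∫ x, u x * f x) - ∫ x, u x * g x) := by
      rw [← integral_const_mul, ← integral_sub (huf.const_mul c) hug, ← integral_const_mul]
      congr 1; ext x
      rw [fracDiv_potentialField hα₀ hα₁ hf hfc x hT0.le]
      ring
    have hpair : |∫ x, u x * fracDiv α (potentialField α T f) x| ≤ A * W := by
      rw [hμ.2 _ hφ, abs_neg]
      refine abs_integral_innerPairing_le hμ.1 measurableSet_closedBall
        (norm_potentialField_le hα₀ hT0.le hf1) fun x hx => ?_
      rw [mem_closedBall_zero_iff, not_le] at hx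
      exact potentialField_eq_zero hf0 hx
    have hug2 : ∫ x, u x * g x ≤ U * (c / 2) := by
      rw [hU, ← integral_mul_const]
      refine integral_mono_ae hug (hu.abs.mul_const _) ?_
      filter_upwards [hu0] with x hx
      by_cases hxR : x ∈ Metric.ball (0 : EuclideanSpace ℝ (Fin n)) R
      · refine (le_abs_self _).trans ?_
        rw [abs_mul]
        exact mul_le_mul_of_nonneg_left (hgle x hxR) (abs_nonneg _)
      · simp [hx hxR]
    have h1 := (le_abs_self _).trans hpair
    rw [hdiv] at h1
    have h2 : A * W / (κ * c) + U / 2 = (A * W + κ * (U * (c / 2))) / (κ * c) := by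
      field_simp
    rw [h2, le_div_iff₀ (by positivity)]
    nlinarith [mul_le_mul_of_nonneg_left hug2 hκ0.le]
  have : 2 * A / (κ * c) * W = 2 * (A * W / (κ * c)) := by ring
  rw [this]
  linarith

end FracBV

/-! ### The variation away from the support of `u`. -/

namespace FracBV

variable {n : ℕ}

open Filter Topology in
/-- Indicators of open sets are pointwise limits of smooth compactly supported functions below
them. -/
theorem exists_seq_contDiff_tendsto_indicator {V : Type*} [NormedAddCommGroup V]
    [InnerProductSpace ℝ V] [FiniteDimensional ℝ V] {U : Set V} (hU : IsOpen U) :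
    ∃ f : ℕ → V → ℝ, (∀ k, ContDiff ℝ ∞ (f k) ∧ HasCompactSupport (f k)) ∧
      (∀ k x, 0 ≤ f k x ∧ f k x ≤ U.indicator 1 x) ∧
      ∀ x, Tendsto (fun k => f k x) atTop (𝓝 (U.indicator 1 x)) := by
  obtain ⟨h, hsupp, hsm, hr⟩ := hU.exists_contDiff_support_eq (n := ⊤)
  have h0 : ∀ x, 0 ≤ h x := fun x => (hr ⟨x, rfl⟩).1
  have h1 : ∀ x, h x ≤ 1 := fun x => (hr ⟨x, rfl⟩).2
  have hout : ∀ x ∉ U, h x = 0 := fun x hx => by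
    rw [← hsupp] at hx; exact Function.notMem_support.1 hx
  have hin : ∀ x ∈ U, 0 < h x := fun x hx => by
    rw [← hsupp] at hx; exact lt_of_le_of_ne (h0 x) (Ne.symm hx)
  let χ : ℕ → ContDiffBump (0 : V) := fun k => ⟨k + 1, k + 2, by positivity, by linarith⟩
  -- With `0 < h ≤ 1` exactly on `U`, the factor `1 - (1 - h)^k` increases to the indicator; the
  -- bumps `χ k` exhaust space and supply compact support.
  refine ⟨fun k x => (1 - (1 - h x) ^ k) * χ k x, fun k => ⟨?_, (χ k).hasCompactSupport.mul_left⟩,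
    fun k x => ?_, fun x => ?_⟩
  · exact (contDiff_const.sub ((contDiff_const.sub hsm).pow k)).mul (χ k).contDiff
  · have e1 : 0 ≤ 1 - (1 - h x) ^ k :=
      sub_nonneg.2 (pow_le_one₀ (by linarith [h1 x]) (by linarith [h0 x]))
    have e2 : 1 - (1 - h x) ^ k ≤ 1 := by
      linarith [pow_nonneg (by linarith [h1 x] : 0 ≤ 1 - h x) k]
    refine ⟨mul_nonneg e1 (χ k).nonneg, ?_⟩
    by_cases hx : x ∈ U
    · rw [Set.indicator_of_mem hx, Pi.one_apply]
      exact mul_le_one₀ e2 (χ k).nonneg (χ k).le_one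
    · rw [Set.indicator_of_notMem hx]; simp [hout x hx]
  · by_cases hx : x ∈ U
    · rw [Set.indicator_of_mem hx, Pi.one_apply]
      have e1 : Tendsto (fun k => 1 - (1 - h x) ^ k) atTop (𝓝 (1 - 0)) :=
        (tendsto_pow_atTop_nhds_zero_of_lt_one (by linarith [h1 x])
          (by linarith [hin x hx])).const_sub 1
      have e2 : Tendsto (fun k => χ k x) atTop (𝓝 1) := by
        refine tendsto_const_nhds.congr' ?_
        filter_upwards [eventually_ge_atTop ⌈‖x‖⌉₊] with k hk
        refine ((χ k).one_of_mem_closedBall ?_).symm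
        rw [mem_closedBall_zero_iff]
        have : ‖x‖ ≤ k := (Nat.le_ceil _).trans (by exact_mod_cast hk)
        change ‖x‖ ≤ (k : ℝ) + 1
        linarith
      simpa using e1.mul e2
    · rw [Set.indicator_of_notMem hx]; simp [hout x hx]

/-- If the pairings of a vector measure with all test fields supported in an open set are bounded
by the integrals of their norms against a finite measure, then this measure dominates the variation
in the open set. -/
theorem variation_le_of_forall_testField
    {μ : VectorMeasure (EuclideanSpace ℝ (Fin n)) (EuclideanSpace ℝ (Fin n))}
    (hμ : μ.variation Set.univ < ⊤) {m : Measure (EuclideanSpace ℝ (Fin n))} [IsFiniteMeasure m]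
    {O : Set (EuclideanSpace ℝ (Fin n))} (hO : IsOpen O)
    (h : ∀ φ, IsTestField φ → (∀ x ∉ O, φ x = 0) →
      |μ.integral φ (innerPairing n)| ≤ ∫ x, ‖φ x‖ ∂m) :
    μ.variation O ≤ m O := by
  have : IsFiniteMeasure μ.variation := ⟨hμ⟩
  have hopen : ∀ U : Set (EuclideanSpace ℝ (Fin n)), IsOpen U → U ⊆ O → ‖μ U‖ ≤ m.real U := by
    intro U hU hUO
    -- Testing in the direction of `μ U` itself makes the limiting pairing equal to `‖μ U‖²`.
    set e := μ U with he
    obtain ⟨f, hf, hf1, hft⟩ := exists_seq_contDiff_tendsto_indicator hU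
    have hind1 : ∀ x : EuclideanSpace ℝ (Fin n), U.indicator (1 : EuclideanSpace ℝ (Fin n) → ℝ) x ≤ 1 := fun x =>
      Set.indicator_le_self' (fun _ _ => zero_le_one) x
    have hbound : ∀ k, |μ.integral (fun x => f k x • e) (innerPairing n)| ≤ m.real U * ‖e‖ := by
      intro k
      refine (h (fun x => f k x • e) ⟨(hf k).1.smul contDiff_const, (hf k).2.smul_right⟩
        fun x hx => ?_).trans ?_
      · have hxU : x ∉ U := fun hx' => hx (hUO hx')
        have := hf1 k x
        rw [Set.indicator_of_notMem hxU] at this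
        simp [le_antisymm this.2 this.1]
      · have hi : Integrable (U.indicator fun _ => ‖e‖) m :=
          (integrable_const _).indicator hU.measurableSet
        have := integral_mono_of_nonneg (μ := m) (f := fun x => ‖f k x • e‖)
          (ae_of_all _ fun x => norm_nonneg _) hi (ae_of_all _ fun x => ?_)
        · rwa [integral_indicator_const _ hU.measurableSet, smul_eq_mul] at this
        · simp only [norm_smul, Real.norm_of_nonneg (hf1 k x).1]
          by_cases hx : x ∈ U
          · rw [Set.indicator_of_mem hx]
            exact mul_le_of_le_one_left (norm_nonneg _) ((hf1 k x).2.trans (hind1 x))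
          · have := hf1 k x
            rw [Set.indicator_of_notMem hx] at this ⊢
            simp [le_antisymm this.2 this.1]
    have hlim : Filter.Tendsto (fun k => μ.integral (fun x => f k x • e) (innerPairing n))
        Filter.atTop (nhds (innerPairing n e (μ U))) := by
      have e1 := VectorMeasure.integral_indicator_const (μ := μ) (B := innerPairing n) e
        hU.measurableSet
      rw [← e1]
      refine tendsto_setToFun_of_dominated_convergence _ (fun _ => ‖e‖) (fun k => ?_)
        (integrable_const _) (fun k => ae_of_all _ fun x => ?_) (ae_of_all _ fun x => ?_)
      · exact ((hf k).1.continuous.smul continuous_const).aestronglyMeasurable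
      · rw [norm_smul, Real.norm_of_nonneg (hf1 k x).1]
        exact mul_le_of_le_one_left (norm_nonneg _) ((hf1 k x).2.trans (hind1 x))
      · have e3 : U.indicator (fun _ => e) x =
            U.indicator (1 : EuclideanSpace ℝ (Fin n) → ℝ) x • e := by
          by_cases hx : x ∈ U <;> simp [hx]
        rw [e3]
        exact (hft x).smul_const e
    have hle := le_of_tendsto hlim.abs (Filter.Eventually.of_forall hbound)
    have e2 : innerPairing n e (μ U) = ‖e‖ ^ 2 := real_inner_self_eq_norm_sq e
    rw [e2, abs_of_nonneg (by positivity), pow_two] at hle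
    rcases eq_or_lt_of_le (norm_nonneg e) with h0 | h0
    · rw [← h0]; positivity
    · exact le_of_mul_le_mul_right hle h0
  refine VectorMeasure.variation_apply_le_of_forall_enorm_le hO.measurableSet fun A hA hAO => ?_
  refine ENNReal.le_of_forall_pos_le_add fun ε hε _ => ?_
  have hε2 : ((ε : ℝ≥0∞) / 2) ≠ 0 := (ENNReal.half_pos (by exact_mod_cast hε.ne')).ne'
  -- Outer regularity of the sum makes the excess `U \ A` small for both measures at once, which
  -- passes the bound from open sets to measurable ones.
  obtain ⟨U₀, hAU₀, hU₀, -, hlt⟩ := hA.exists_isOpen_sdiff_lt (μ := μ.variation + m)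
    (measure_ne_top _ _) hε2
  set U := U₀ ∩ O with hUdef
  have hU : IsOpen U := hU₀.inter hO
  have hAU : A ⊆ U := Set.subset_inter hAU₀ hAO
  have hdiff : (μ.variation + m) (U \ A) < ε / 2 :=
    (measure_mono (Set.sdiff_subset_sdiff_left Set.inter_subset_left)).trans_lt hlt
  rw [Measure.add_apply] at hdiff
  have hsplit : μ U = μ A + μ (U \ A) := by
    rw [VectorMeasure.of_add_of_sdiff hA hU.measurableSet hAU]
  have h1 : ‖μ A‖ₑ ≤ ‖μ U‖ₑ + ‖μ (U \ A)‖ₑ := by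
    rw [eq_sub_of_add_eq hsplit.symm]
    exact enorm_sub_le
  have h2 : ‖μ U‖ₑ ≤ m U := by
    rw [← ofReal_norm, ← ENNReal.ofReal_toReal (measure_ne_top m U)]
    exact ENNReal.ofReal_le_ofReal (hopen U hU Set.inter_subset_right)
  have h3 : m U ≤ m A + m (U \ A) := by
    conv_lhs => rw [← Set.union_sdiff_cancel hAU]
    exact measure_union_le _ _
  calc ‖μ A‖ₑ ≤ (m A + m (U \ A)) + μ.variation (U \ A) :=
        h1.trans (add_le_add (h2.trans h3) (VectorMeasure.enorm_measure_le_variation μ _))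
    _ = m A + (μ.variation (U \ A) + m (U \ A)) := by ring
    _ ≤ m A + ε := by
        gcongr
        exact hdiff.le.trans ENNReal.half_le_self

theorem norm_le_two_mul_norm_sub {V : Type*} [NormedAddCommGroup V] {R : ℝ} {x y : V}
    (hx : ‖x‖ < R) (hy : 2 * R < ‖y‖) : ‖y‖ / 2 ≤ ‖y - x‖ := by
  linarith [norm_sub_norm_le y x]

/-- Away from the support of `u`, the fractional divergence of a field is bounded by an integral
of the field against a decaying kernel. -/
theorem abs_fracDiv_le_of_eq_zero {α : ℝ} (hα₀ : 0 < α) (hα₁ : α < 1) {R : ℝ} (hR : 0 < R)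
    {φ : EuclideanSpace ℝ (Fin n) → EuclideanSpace ℝ (Fin n)} (hφ : IsTestField φ)
    (hφ0 : ∀ y, ‖y‖ ≤ 2 * R → φ y = 0) {x : EuclideanSpace ℝ (Fin n)} (hx : ‖x‖ < R) :
    |fracDiv α φ x| ≤ gradConst n α *
      ∫ y in {y : EuclideanSpace ℝ (Fin n) | 2 * R < ‖y‖}, ‖φ y‖ * (‖y‖ / 2) ^ (-((n : ℝ) + α)) := by
  have hn : (0 : ℝ) ≤ n := Nat.cast_nonneg n
  rw [fracDiv, abs_mul, abs_of_pos (gradConst_pos hα₀ hα₁)]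
  refine mul_le_mul_of_nonneg_left ?_ (gradConst_pos hα₀ hα₁).le
  have hS : MeasurableSet {y : EuclideanSpace ℝ (Fin n) | 2 * R < ‖y‖} :=
    measurableSet_lt measurable_const measurable_norm
  rw [← integral_indicator hS]
  have hφx : φ x = 0 := hφ0 x (by linarith)
  have hφi : Integrable fun y => ‖φ y‖ :=
    (hφ.1.continuous.integrable_of_hasCompactSupport hφ.2).norm
  have hpm : Measurable fun y : EuclideanSpace ℝ (Fin n) => (‖y‖ / 2) ^ (-((n : ℝ) + α)) := by
    fun_prop
  rw [← Real.norm_eq_abs]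
  refine norm_integral_le_of_norm_le ?_ (ae_of_all _ fun y => ?_)
  · rw [integrable_indicator_iff hS]
    refine (hφi.integrableOn.mul_const (R ^ (-((n : ℝ) + α)))).mono'
      (hφi.aestronglyMeasurable.mul hpm.aestronglyMeasurable).restrict ?_
    refine (ae_restrict_iff' hS).2 (ae_of_all _ fun y (hy : 2 * R < ‖y‖) => ?_)
    rw [norm_mul, norm_norm, Real.norm_of_nonneg (by positivity)]
    gcongr ?_ * ?_
    exact Real.rpow_le_rpow_of_nonpos hR (by linarith) (by linarith)
  · by_cases hy : 2 * R < ‖y‖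
    · rw [Set.indicator_of_mem (show y ∈ {y | 2 * R < ‖y‖} from hy), hφx, sub_zero, norm_div]
      have h1 := norm_le_two_mul_norm_sub hx hy
      have h0 : 0 < ‖y - x‖ := by linarith
      rw [Real.norm_of_nonneg (by positivity : 0 ≤ ‖y - x‖ ^ ((n : ℝ) + α + 1)),
        div_le_iff₀ (by positivity)]
      calc ‖inner ℝ (φ y) (y - x)‖ ≤ ‖φ y‖ * ‖y - x‖ := norm_inner_le_norm _ _
        _ = ‖φ y‖ * (‖y - x‖ ^ (-((n : ℝ) + α)) * ‖y - x‖ ^ ((n : ℝ) + α + 1)) := by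
            rw [← Real.rpow_add h0]; ring_nf; simp
        _ ≤ ‖φ y‖ * ((‖y‖ / 2) ^ (-((n : ℝ) + α)) * ‖y - x‖ ^ ((n : ℝ) + α + 1)) := by
            gcongr ‖φ y‖ * (?_ * _)
            exact Real.rpow_le_rpow_of_nonpos (by linarith) h1 (by linarith)
        _ = _ := by ring
    · rw [Set.indicator_of_notMem (show y ∉ {y | 2 * R < ‖y‖} from hy), hφx,
        hφ0 y (not_lt.1 hy)]
      simp

/-- Far from the support of `u`, the fractional variation is controlled by the `L¹` norm. -/
theorem exists_variation_far_le {α : ℝ} (hα₀ : 0 < α) (hα₁ : α < 1) {R : ℝ} (hR : 0 < R) :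
    ∃ C : ℝ, 0 ≤ C ∧ ∀ (u : EuclideanSpace ℝ (Fin n) → ℝ)
      (μ : VectorMeasure (EuclideanSpace ℝ (Fin n)) (EuclideanSpace ℝ (Fin n))),
      Integrable u →
      (∀ᵐ x, x ∉ Metric.ball (0 : EuclideanSpace ℝ (Fin n)) R → u x = 0) →
      IsFracVariation α u μ →
      μ.variation {y | 2 * R < ‖y‖} ≤ ENNReal.ofReal (C * ∫ x, |u x|) := by
  have hn : (0 : ℝ) ≤ n := Nat.cast_nonneg n
  set S := {y : EuclideanSpace ℝ (Fin n) | 2 * R < ‖y‖} with hSdef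
  have hSo : IsOpen S := isOpen_lt continuous_const continuous_norm
  set ρ : EuclideanSpace ℝ (Fin n) → ℝ := fun y => (‖y‖ / 2) ^ (-((n : ℝ) + α)) with hρ
  have hρ0 : ∀ y, 0 ≤ ρ y := fun y => by positivity
  have hρm : Measurable ρ := by fun_prop
  have hρi : IntegrableOn ρ S := by
    have hb := (integrable_one_add_norm (E := EuclideanSpace ℝ (Fin n)) (μ := volume)
      (r := (n : ℝ) + α) (by rw [finrank_euclideanSpace_fin]; linarith)).const_mul
        -- For `‖y‖ > 2R` one has `(1 + ‖y‖) R / (1 + 2R) ≤ ‖y‖ / 2`.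
        (((1 + 2 * R) / R) ^ ((n : ℝ) + α))
    refine hb.integrableOn.mono' hρm.aestronglyMeasurable ?_
    refine (ae_restrict_iff' hSo.measurableSet).2 (ae_of_all _ fun y (hy : 2 * R < ‖y‖) => ?_)
    have hc : 0 < (1 + 2 * R) / R := by positivity
    have e1 : ((1 + 2 * R) / R) ^ ((n : ℝ) + α) = (((1 + 2 * R) / R)⁻¹) ^ (-((n : ℝ) + α)) := by
      rw [Real.rpow_neg (by positivity), Real.inv_rpow hc.le, inv_inv]
    rw [Real.norm_of_nonneg (hρ0 y), e1, ← Real.mul_rpow (by positivity) (by positivity)]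
    refine Real.rpow_le_rpow_of_nonpos (by positivity) ?_ (by linarith)
    rw [inv_div, div_mul_eq_mul_div, div_le_div_iff₀ (by positivity) (by norm_num)]
    nlinarith
  set J := ∫ y in S, ρ y with hJ
  have hJ0 : 0 ≤ J := integral_nonneg fun y => hρ0 y
  have hg := gradConst_pos (n := n) hα₀ hα₁
  refine ⟨gradConst n α * J, by positivity, fun u μ hu hu0 hμ => ?_⟩
  set U := ∫ x, |u x| with hU
  have hU0 : 0 ≤ U := integral_nonneg fun x => abs_nonneg _
  set w : EuclideanSpace ℝ (Fin n) → ℝ := fun y => U * gradConst n α * ρ y with hw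
  have hw0 : ∀ y, 0 ≤ w y := fun y => by have := hρ0 y; positivity
  have hwm : Measurable w := by fun_prop
  have hwi : IntegrableOn w S := hρi.const_mul _
  -- The comparison measure: its density is the decaying kernel bound for `div^α`, multiplied by the
  -- `L¹` norm of `u`.
  set m := (volume.restrict S).withDensity (fun y => ENNReal.ofReal (w y)) with hm
  have hfin : IsFiniteMeasure m := isFiniteMeasure_withDensity_ofReal hwi.2
  have hmS : m S = ENNReal.ofReal (gradConst n α * J * U) := by
    rw [hm, withDensity_apply _ hSo.measurableSet, Measure.restrict_restrict hSo.measurableSet,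
      Set.inter_self, ← ofReal_integral_eq_lintegral_ofReal hwi (ae_of_all _ hw0)]
    congr 1
    rw [hw, integral_const_mul]; ring
  rw [← hmS]
  refine variation_le_of_forall_testField hμ.1 hSo fun φ hφ hφ0 => ?_
  have h1 : |∫ x, u x * fracDiv α φ x| ≤ ∫ x, |u x| * (gradConst n α * ∫ y in S, ‖φ y‖ * ρ y) := by
    rw [← Real.norm_eq_abs]
    refine norm_integral_le_of_norm_le (hu.abs.mul_const _) ?_
    filter_upwards [hu0] with x hx
    by_cases hxR : x ∈ Metric.ball (0 : EuclideanSpace ℝ (Fin n)) R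
    · rw [norm_mul]
      refine mul_le_mul_of_nonneg_left ?_ (norm_nonneg _)
      exact abs_fracDiv_le_of_eq_zero hα₀ hα₁ hR hφ
        (fun y hy => hφ0 y (not_lt.2 hy)) (by simpa using hxR)
    · simp [hx hxR]
  rw [hμ.2 φ hφ, abs_neg, integral_mul_const] at h1
  refine h1.trans (le_of_eq ?_)
  rw [hm, integral_withDensity_eq_integral_toReal_smul (by fun_prop)
    (ae_of_all _ fun _ => ENNReal.ofReal_lt_top), ← hU, ← mul_assoc, ← integral_const_mul]
  congr 1; ext y
  rw [ENNReal.toReal_ofReal (hw0 y), hw, smul_eq_mul]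
  ring

end FracBV

/-! ### Existence of the fractional variation measure. -/

namespace FracBV

theorem variation_withDensityVec_le {X V : Type*} [MeasurableSpace X] [NormedAddCommGroup V]
    [NormedSpace ℝ V] [CompleteSpace V] {ν : Measure X} {g : X → V}
    (hg : Integrable g ν) (hg1 : ∀ x, ‖g x‖ ≤ 1) : (ν.withDensityᵥ g).variation ≤ ν := by
  rw [Measure.variation_withDensityᵥ hg]
  refine (withDensity_mono (g := 1) (ae_of_all _ fun x => ?_)).trans_eq withDensity_one
  rw [Pi.one_apply, ← ofReal_norm]
  exact ENNReal.ofReal_le_one.2 (hg1 x)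

/-- Integration against a finite measure with bounded vector-valued density. -/
theorem integral_withDensityVec_eq {X V : Type*} [MeasurableSpace X] [NormedAddCommGroup V]
    [InnerProductSpace ℝ V] [CompleteSpace V] {ν : Measure X} [IsFiniteMeasure ν] {g : X → V}
    (hg : Integrable g ν) (hg1 : ∀ x, ‖g x‖ ≤ 1) {f : X → V} (hf : Integrable f ν) :
    (ν.withDensityᵥ g).integral f (innerSL ℝ) = ∫ x, inner ℝ (f x) (g x) ∂ν := by
  have hvar := variation_withDensityVec_le hg hg1
  have hbd : ∀ (f : X → V) x, ‖inner ℝ (f x) (g x)‖ ≤ ‖f x‖ := fun f x =>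
    (norm_inner_le_norm _ _).trans (mul_le_of_le_one_right (norm_nonneg _) (hg1 x))
  have hint : ∀ {f : X → V}, Integrable f ν → Integrable (fun x => inner ℝ (f x) (g x)) ν :=
    fun {f} hf => hf.norm.mono' (hf.1.inner hg.1) (ae_of_all _ (hbd f))
  refine Integrable.induction (P := fun f => (ν.withDensityᵥ g).integral f (innerSL ℝ) =
    ∫ x, inner ℝ (f x) (g x) ∂ν) (fun c s hs hsf => ?_) (fun f g' _ hf hg' hPf hPg => ?_) ?_
    (fun f f' h _ hP => ?_) hf
  · have : IsFiniteMeasure (ν.withDensityᵥ g).variation := isFiniteMeasure_of_le ν hvar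
    have e : ∀ x, inner ℝ (s.indicator (fun _ => c) x) (g x) =
        s.indicator (fun x => inner ℝ c (g x)) x := fun x => by
      by_cases hx : x ∈ s <;> simp [hx]
    simp_rw [e]
    rw [VectorMeasure.integral_indicator_const _ hs, integral_indicator hs,
      withDensityᵥ_apply hg hs]
    exact ((innerSL ℝ c).integral_comp_comm hg.integrableOn).symm
  · simp_rw [Pi.add_apply, inner_add_left]
    rw [MeasureTheory.integral_add (hint hf) (hint hg'), ← hPf, ← hPg]
    exact VectorMeasure.integral_add (hf.mono_measure hvar) (hg'.mono_measure hvar)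
  -- Both sides are continuous on `L¹(ν)`. On the left the set function is regarded as dominated by
  -- `ν` rather than by its own variation, which does not change the integral; on the right the map
  -- is `1`-Lipschitz.
  · refine isClosed_eq ?_ ?_
    · have hT := (dominatedFinMeasAdditive_cbmApplyMeasure (ν.withDensityᵥ g)
        (innerSL ℝ))
      have hT' := hT.of_measure_le hvar (by positivity)
      refine (continuous_setToFun hT').congr fun f => ?_
      exact setToFun_congr_measure_of_integrable 1 ENNReal.one_ne_top (by simpa using hvar) hT' hT
        f (L1.integrable_coeFn f)
    · refine LipschitzWith.continuous (K := 1) (LipschitzWith.of_dist_le_mul fun f f' => ?_)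
      have hf := L1.integrable_coeFn f
      have hf' := L1.integrable_coeFn f'
      rw [NNReal.coe_one, one_mul, dist_eq_norm, ← MeasureTheory.integral_sub (hint hf) (hint hf'),
        L1.dist_eq_integral_dist]
      simp_rw [dist_eq_norm]
      refine norm_integral_le_of_norm_le (hf.sub hf').norm (ae_of_all _ fun x => ?_)
      rw [← inner_sub_left]
      exact hbd (fun x => f x - f' x) x
  · rw [← VectorMeasure.integral_congr_ae (Measure.absolutelyContinuous_of_le hvar h), hP]
    exact MeasureTheory.integral_congr_ae (h.mono fun x hx => by simp only [hx])

open scoped CompactlySupported in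
/-- A positive functional on compactly supported functions which is bounded with respect to the
supremum of the positive part is represented by a finite measure. -/
theorem isFiniteMeasure_rieszMeasure {X : Type*} [TopologicalSpace X] [T2Space X]
    [LocallyCompactSpace X] [MeasurableSpace X] [BorelSpace X] (Λ : C_c(X, ℝ) →ₚ[ℝ] ℝ) {M : ℝ}
    (hM : ∀ f : C_c(X, ℝ), (∀ x, f x ≤ 1) → Λ f ≤ M) :
    IsFiniteMeasure (RealRMK.rieszMeasure Λ) := by
  refine ⟨?_⟩
  rw [isOpen_univ.measure_eq_iSup_isCompact]
  refine (iSup₂_le fun K _ => iSup_le fun hK => ?_).trans_lt (ENNReal.ofReal_lt_top (r := M))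
  obtain ⟨f, hf1, -, hfc, hf01⟩ := exists_continuous_one_zero_of_isCompact hK isClosed_empty
    (Set.disjoint_empty _)
  let F : C_c(X, ℝ) := ⟨f, hfc⟩
  refine (RealRMK.rieszMeasure_le_of_eq_one Λ (f := F) (fun x => (hf01 x).1) hK
    fun x hx => hf1 hx).trans (ENNReal.ofReal_le_ofReal (hM F fun x => (hf01 x).2))
end FracBV

namespace FracBV

variable {n : ℕ}

section Pairing

variable [Nontrivial (EuclideanSpace ℝ (Fin n))] {α : ℝ}
  {φ ψ : EuclideanSpace ℝ (Fin n) → EuclideanSpace ℝ (Fin n)}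
  {u : EuclideanSpace ℝ (Fin n) → ℝ}

theorem exists_norm_inner_div_le (hφ : IsTestField φ) (α : ℝ) :
    ∃ C : ℝ, 0 ≤ C ∧ ∀ x h : EuclideanSpace ℝ (Fin n), ‖inner ℝ (φ (x + h) - φ x) h /
      ‖h‖ ^ ((Module.finrank ℝ (EuclideanSpace ℝ (Fin n)) : ℝ) + α + 1)‖ ≤
        C * singularMajorant α h := by
  obtain ⟨C, hC0, hC⟩ := exists_norm_add_sub_le hφ.1 hφ.2
  refine ⟨C, hC0, fun x h => ?_⟩
  rcases eq_or_ne h 0 with rfl | hh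
  · simpa using mul_nonneg hC0 (singularMajorant_nonneg α 0)
  have h0 : 0 < ‖h‖ := norm_pos_iff.2 hh
  have h1 := norm_div_rpow_le_singularMajorant (α := α) (C := C) (c := ‖φ (x + h) - φ x‖)
    (‖h‖⁻¹ • h) h (by rw [abs_norm]; exact hC x h)
  have e1 : ‖‖h‖⁻¹ • h‖ = 1 := by
    rw [norm_smul, norm_inv, norm_norm, inv_mul_cancel₀ h0.ne']
  have e2 : inner ℝ (‖h‖⁻¹ • h) h = ‖h‖ := by
    rw [real_inner_smul_left, real_inner_self_eq_norm_sq]; field_simp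
  rw [e1, e2, mul_one, abs_div, abs_of_nonneg (by positivity)] at h1
  rw [norm_div]
  refine le_trans ?_ h1
  rw [Real.norm_eq_abs (‖h‖ ^ _)]
  gcongr
  exact norm_inner_le_norm _ _

theorem measurable_inner_div (hφ : IsTestField φ) (α : ℝ) :
    Measurable fun p : EuclideanSpace ℝ (Fin n) × EuclideanSpace ℝ (Fin n) =>
      inner ℝ (φ (p.1 + p.2) - φ p.1) p.2 /
        ‖p.2‖ ^ ((Module.finrank ℝ (EuclideanSpace ℝ (Fin n)) : ℝ) + α + 1) := by
  have := hφ.1.continuous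
  refine Measurable.div (Continuous.measurable (by fun_prop)) ?_
  exact (measurable_snd.norm).pow_const _

theorem integrable_inner_div (hα₀ : 0 < α) (hα₁ : α < 1) (hφ : IsTestField φ)
    (x : EuclideanSpace ℝ (Fin n)) :
    Integrable fun h => inner ℝ (φ (x + h) - φ x) h /
      ‖h‖ ^ ((Module.finrank ℝ (EuclideanSpace ℝ (Fin n)) : ℝ) + α + 1) := by
  obtain ⟨C, -, hC⟩ := exists_norm_inner_div_le hφ α
  exact ((integrable_singularMajorant hα₀ hα₁).const_mul C).mono'
    ((measurable_inner_div hφ α).comp measurable_prodMk_left).aestronglyMeasurable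
    (ae_of_all _ (hC x))

theorem fracDiv_add (hα₀ : 0 < α) (hα₁ : α < 1) (hφ : IsTestField φ) (hψ : IsTestField ψ)
    (x : EuclideanSpace ℝ (Fin n)) :
    fracDiv α (φ + ψ) x = fracDiv α φ x + fracDiv α ψ x := by
  simp_rw [fracDiv_eq_integral_add]
  rw [← mul_add, ← integral_add (integrable_inner_div hα₀ hα₁ hφ x)
    (integrable_inner_div hα₀ hα₁ hψ x)]
  congr 2; ext h
  rw [← add_div, ← inner_add_left]
  congr 2
  simp only [Pi.add_apply]
  abel

theorem fracDiv_smul (c : ℝ) (φ : EuclideanSpace ℝ (Fin n) → EuclideanSpace ℝ (Fin n))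
    (x : EuclideanSpace ℝ (Fin n)) :
    fracDiv α (c • φ) x = c * fracDiv α φ x := by
  simp_rw [fracDiv, Pi.smul_apply, ← smul_sub, real_inner_smul_left, mul_div_assoc]
  rw [integral_const_mul]
  ring

theorem integrable_mul_fracDiv (hα₀ : 0 < α) (hα₁ : α < 1) (hφ : IsTestField φ)
    (hu : Integrable u) : Integrable fun x => u x * fracDiv α φ x := by
  obtain ⟨C, -, hC⟩ := exists_norm_inner_div_le hφ α
  simp_rw [fracDiv_eq_integral_add]
  have hm := (measurable_inner_div hφ α).stronglyMeasurable.integral_prod_right'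
    (ν := (volume : Measure (EuclideanSpace ℝ (Fin n))))
  refine hu.mul_bdd (c := |gradConst n α| *
      ∫ h : EuclideanSpace ℝ (Fin n), C * singularMajorant α h)
    (hm.const_mul _).aestronglyMeasurable (ae_of_all _ fun x => ?_)
  rw [norm_mul]
  refine mul_le_mul_of_nonneg_left ?_ (abs_nonneg _)
  exact norm_integral_le_of_norm_le ((integrable_singularMajorant hα₀ hα₁).const_mul C)
    (ae_of_all _ (hC x))

end Pairing

/-- The space of test fields. -/
def testFields (n : ℕ) : Submodule ℝ (EuclideanSpace ℝ (Fin n) → EuclideanSpace ℝ (Fin n)) where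
  carrier := {φ | IsTestField φ}
  zero_mem' := ⟨contDiff_const, HasCompactSupport.zero⟩
  add_mem' h h' := ⟨h.1.add h'.1, h.2.add h'.2⟩
  smul_mem' _ _ h := ⟨contDiff_const.smul h.1, h.2.smul_left⟩

open scoped CompactlySupported

/-- A test field, viewed as a function of a point and a direction. -/
noncomputable def testFieldPairing (n : ℕ) :
    testFields n →ₗ[ℝ]
      C_c(EuclideanSpace ℝ (Fin n) × Metric.sphere (0 : EuclideanSpace ℝ (Fin n)) 1, ℝ) where
  toFun φ :=
    { toFun := fun p => inner ℝ (φ.1 p.1) (p.2 : EuclideanSpace ℝ (Fin n))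
      continuous_toFun := (φ.2.1.continuous.comp continuous_fst).inner
        (continuous_subtype_val.comp continuous_snd)
      hasCompactSupport' := by
        refine HasCompactSupport.intro (K := tsupport φ.1 ×ˢ Set.univ)
          (φ.2.2.isCompact.prod isCompact_univ) fun p hp => ?_
        have : p.1 ∉ tsupport φ.1 := fun h => hp ⟨h, trivial⟩
        simp [image_eq_zero_of_notMem_tsupport this] }
  map_add' φ ψ := by ext p; exact inner_add_left (𝕜 := ℝ) (φ.1 p.1) (ψ.1 p.1) _
  map_smul' c φ := by ext p; exact real_inner_smul_left (φ.1 p.1) _ c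

theorem testFieldPairing_apply (φ : testFields n)
    (p : EuclideanSpace ℝ (Fin n) × Metric.sphere (0 : EuclideanSpace ℝ (Fin n)) 1) :
    testFieldPairing n φ p = inner ℝ (φ.1 p.1) (p.2 : EuclideanSpace ℝ (Fin n)) := rfl

/-- Evaluate at the direction of `φ x`. One-sided bounds on the pairing thus control the Euclidean
norm, so the supremum of the positive part is the right sublinear functional. -/
theorem norm_le_of_testFieldPairing_le {φ : testFields n} {s : ℝ} (hs : 0 ≤ s)
    (h : ∀ p, testFieldPairing n φ p ≤ s) (x : EuclideanSpace ℝ (Fin n)) : ‖φ.1 x‖ ≤ s := by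
  rcases eq_or_ne (φ.1 x) 0 with h0 | h0
  · rwa [h0, norm_zero]
  have hp : 0 < ‖φ.1 x‖ := norm_pos_iff.2 h0
  have := h (x, ⟨‖φ.1 x‖⁻¹ • φ.1 x, by
    rw [mem_sphere_zero_iff_norm, norm_smul, norm_inv, norm_norm, inv_mul_cancel₀ hp.ne']⟩)
  rw [testFieldPairing_apply, real_inner_smul_right, real_inner_self_eq_norm_sq] at this
  rwa [pow_two, inv_mul_cancel_left₀ hp.ne'] at this

theorem testFieldPairing_injective (n : ℕ) : Function.Injective (testFieldPairing n) := by
  rw [injective_iff_map_eq_zero]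
  intro φ h
  ext1; funext x
  exact norm_le_zero_iff.1 (norm_le_of_testFieldPairing_le le_rfl (fun p => by rw [h]; rfl) x)

/-- A linear functional bounded above on the unit ball of the test fields is represented by a
vector measure of finite variation. -/
theorem exists_vectorMeasure_of_forall_le (L : testFields n →ₗ[ℝ] ℝ) {M : ℝ}
    (hM : ∀ φ : testFields n, (∀ x, ‖φ.1 x‖ ≤ 1) → L φ ≤ M) :
    ∃ μ : VectorMeasure (EuclideanSpace ℝ (Fin n)) (EuclideanSpace ℝ (Fin n)),
      μ.variation Set.univ < ⊤ ∧ ∀ φ : testFields n, μ.integral φ.1 (innerPairing n) = L φ := by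
  set X := EuclideanSpace ℝ (Fin n) × Metric.sphere (0 : EuclideanSpace ℝ (Fin n)) 1 with hX
  have hM0 : 0 ≤ M := by simpa using hM 0 (by simp)
  have hle : ∀ (φ : testFields n) (s : ℝ), 0 ≤ s → (∀ x, ‖φ.1 x‖ ≤ s) → L φ ≤ M * s := by
    intro φ s hs h
    rcases hs.eq_or_lt with rfl | hs
    · have : φ = 0 := by ext1; funext x; exact norm_le_zero_iff.1 (h x)
      simp [this]
    · have := hM (s⁻¹ • φ) fun x => by
        change ‖s⁻¹ • φ.1 x‖ ≤ 1
        rw [norm_smul, norm_inv, Real.norm_of_nonneg hs.le, inv_mul_le_one₀ hs]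
        exact h x
      rwa [map_smul, smul_eq_mul, inv_mul_le_iff₀ hs, mul_comm] at this
  -- Using the positive part rather than the absolute value makes every dominated extension
  -- automatically positive, so that Riesz–Markov applies without a Jordan decomposition.
  set P : C_c(X, ℝ) → ℝ := fun f => ⨆ x, max (f x) 0 with hP
  have hbdd : ∀ f : C_c(X, ℝ), BddAbove (Set.range fun x => max (f x) 0) := by
    intro f
    obtain ⟨C, hC⟩ := f.continuous.bounded_above_of_compact_support f.hasCompactSupport
    refine ⟨C, ?_⟩
    rintro _ ⟨x, rfl⟩
    exact max_le ((le_abs_self _).trans (hC x)) ((norm_nonneg _).trans (hC x))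
  have hP0 : ∀ f, 0 ≤ P f := fun f => Real.iSup_nonneg fun x => le_max_right _ _
  have hfP : ∀ f x, f x ≤ P f := fun f x => (le_max_left _ _).trans (le_ciSup (hbdd f) x)
  have hPle : ∀ (f : C_c(X, ℝ)) (a : ℝ), 0 ≤ a → (∀ x, f x ≤ a) → P f ≤ a :=
    fun f a ha h => Real.iSup_le (fun x => max_le (h x) ha) ha
  have hPadd : ∀ f g, P (f + g) ≤ P f + P g := fun f g =>
    hPle _ _ (add_nonneg (hP0 f) (hP0 g)) fun x => add_le_add (hfP f x) (hfP g x)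
  have hPsmul : ∀ c : ℝ, 0 < c → ∀ f, P (c • f) = c * P f := by
    intro c hc f
    rw [hP, Real.mul_iSup_of_nonneg hc.le]
    refine iSup_congr fun x => ?_
    rw [mul_max_of_nonneg _ _ hc.le, mul_zero]; rfl
  set T := testFieldPairing n with hT
  let e := LinearEquiv.ofInjective T (testFieldPairing_injective n)
  obtain ⟨G, hGext, hGle⟩ := exists_extension_of_le_sublinear
    (E := C_c(X, ℝ)) ⟨LinearMap.range T, L ∘ₗ e.symm.toLinearMap⟩ (fun f => M * P f)
    (fun c hc f => by rw [hPsmul c hc]; ring)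
    (fun f g => by rw [← mul_add]; exact mul_le_mul_of_nonneg_left (hPadd f g) hM0)
    (fun f => by
      obtain ⟨φ, rfl⟩ := e.surjective f
      change L (e.symm (e φ)) ≤ M * P (T φ)
      rw [LinearEquiv.symm_apply_apply]
      exact hle φ _ (hP0 _) (norm_le_of_testFieldPairing_le (hP0 _) (hfP _)))
  have hGT : ∀ φ, G (T φ) = L φ := fun φ => by
    refine (hGext (e φ)).trans ?_
    change L (e.symm (e φ)) = L φ
    rw [LinearEquiv.symm_apply_apply]
  have hGpos : ∀ f : C_c(X, ℝ), 0 ≤ f → 0 ≤ G f := by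
    intro f hf
    have h1 := hGle (-f)
    have h2 : P (-f) ≤ 0 := hPle _ _ le_rfl fun x => neg_nonpos.2 (hf x)
    rw [map_neg] at h1
    nlinarith
  let Λ : C_c(X, ℝ) →ₚ[ℝ] ℝ := PositiveLinearMap.mk₀ G hGpos
  set ν := RealRMK.rieszMeasure Λ with hν
  have hfin : IsFiniteMeasure ν := isFiniteMeasure_rieszMeasure Λ (M := M) fun f hf =>
    (hGle f).trans (mul_le_of_le_one_right hM0 (hPle f 1 zero_le_one hf))
  -- The vector measure is the push-forward to space of the direction times `ν`; its variation is at
  -- most the push-forward of `ν`, as directions have norm one.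
  let g : X → EuclideanSpace ℝ (Fin n) := fun p => p.2
  have hg1 : ∀ p, ‖g p‖ ≤ 1 := fun p => (mem_sphere_zero_iff_norm.1 p.2.2).le
  have hgc : Continuous g := continuous_subtype_val.comp continuous_snd
  have hgi : Integrable g ν := (integrable_const (1 : ℝ)).mono' hgc.aestronglyMeasurable
    (ae_of_all _ hg1)
  have hvar := variation_withDensityVec_le hgi hg1
  have : IsFiniteMeasure (ν.withDensityᵥ g).variation := isFiniteMeasure_of_le ν hvar
  refine ⟨(ν.withDensityᵥ g).map Prod.fst, ?_, fun φ => ?_⟩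
  · exact (VectorMeasure.variation_map_le _).trans_lt (measure_lt_top _ _)
  · have hφc := φ.2.1.continuous
    obtain ⟨C, hC⟩ := hφc.bounded_above_of_compact_support φ.2.2
    have hφi : Integrable (φ.1 ∘ Prod.fst) ν := (integrable_const C).mono'
      (hφc.comp continuous_fst).aestronglyMeasurable (ae_of_all _ fun p => hC p.1)
    rw [VectorMeasure.integral_map measurable_fst hφc.aestronglyMeasurable
      (hφi.mono_measure hvar)]
    refine (integral_withDensityVec_eq hgi hg1 hφi).trans ?_
    rw [← hGT φ]
    exact RealRMK.integral_rieszMeasure Λ (T φ)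

/-- Every function of bounded fractional variation has a fractional variation measure. -/
theorem exists_isFracVariation [Nontrivial (EuclideanSpace ℝ (Fin n))] {α : ℝ} (hα₀ : 0 < α)
    (hα₁ : α < 1) {u : EuclideanSpace ℝ (Fin n) → ℝ} (hu : MemBV α u) :
    ∃ μ, IsFracVariation α u μ := by
  obtain ⟨hui, M, hM⟩ := hu
  let L : testFields n →ₗ[ℝ] ℝ :=
    { toFun := fun φ => -∫ x, u x * fracDiv α φ.1 x
      map_add' := fun φ ψ => by
        rw [← neg_add, ← integral_add (integrable_mul_fracDiv hα₀ hα₁ φ.2 hui)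
          (integrable_mul_fracDiv hα₀ hα₁ ψ.2 hui)]
        congr 2; ext x
        rw [← mul_add, ← fracDiv_add hα₀ hα₁ φ.2 ψ.2]
        rfl
      map_smul' := fun c φ => by
        rw [RingHom.id_apply, smul_eq_mul, mul_neg, ← integral_const_mul]
        congr 2; ext x
        rw [mul_left_comm c, ← fracDiv_smul c]
        rfl }
  obtain ⟨μ, hμ, hμL⟩ := exists_vectorMeasure_of_forall_le L (M := M) fun φ hφ => by
    rw [← neg_neg φ, map_neg]
    refine (le_of_eq (neg_neg _)).trans (hM ⟨(-φ).1, (-φ).2, fun x => ?_, rfl⟩)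
    change ‖-φ.1 x‖ ≤ 1
    rw [norm_neg]; exact hφ x
  refine ⟨μ, hμ, fun φ hφ => ?_⟩
  rw [hμL ⟨φ, hφ⟩]
  exact (neg_neg _).symm

/-- Rules out the default value `0`. Uniqueness is not needed, as the estimates hold for every
fractional variation measure. -/
theorem isFracVariation_fracVariation [Nontrivial (EuclideanSpace ℝ (Fin n))] {α : ℝ}
    (hα₀ : 0 < α) (hα₁ : α < 1) {u : EuclideanSpace ℝ (Fin n) → ℝ} (hu : MemBV α u) :
    IsFracVariation α u (fracVariation α u) := by
  have h := exists_isFracVariation hα₀ hα₁ hu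
  rw [fracVariation, dif_pos h]
  exact h.choose_spec

end FracBV

theorem proposition3p4 (n : ℕ) (hn : 1 ≤ n) (α : ℝ) (hα₀ : 0 < α) (hα₁ : α < 1)
    (Ω : Set (EuclideanSpace ℝ (Fin n))) (hΩ : IsOpen Ω) (hΩb : Bornology.IsBounded Ω) :
    ∃ Ω' : Set (EuclideanSpace ℝ (Fin n)),
      IsOpen Ω' ∧ Bornology.IsBounded Ω' ∧ FracBV.CompactlyContained Ω Ω' ∧
      ∃ C : ℝ, 0 < C ∧
        ∀ u : EuclideanSpace ℝ (Fin n) → ℝ, FracBV.MemBVZero α Ω u →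
          FracBV.bvNorm α u ≤ ENNReal.ofReal C * FracBV.totalFracVariation α u Ω' := by
  have : Nonempty (Fin n) := ⟨⟨0, hn⟩⟩
  have : Nontrivial (EuclideanSpace ℝ (Fin n)) := inferInstance
  obtain ⟨R, hR, hΩR⟩ : ∃ R : ℝ, 0 < R ∧ Ω ⊆ Metric.ball 0 R := by
    obtain ⟨R, hR⟩ := hΩb.subset_ball (0 : EuclideanSpace ℝ (Fin n))
    exact ⟨max R 1, by positivity, hR.trans (Metric.ball_subset_ball (le_max_left _ _))⟩
  obtain ⟨R', C₁, hC₁, hpoinc⟩ := FracBV.exists_integral_abs_le_variation (n := n) hα₀ hα₁ hR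
  obtain ⟨C₂, hC₂, hfar⟩ := FracBV.exists_variation_far_le (n := n) hα₀ hα₁ hR
  -- The open ball must contain the closed ball of the `L¹` estimate, contain the closure of `Ω`,
  -- and cover space together with the far region `‖y‖ > 2R`.
  set r := max (R' + 1) (2 * R + 1) with hr
  refine ⟨Metric.ball 0 r, Metric.isOpen_ball, Metric.isBounded_ball,
    ⟨(closure_minimal (hΩR.trans Metric.ball_subset_closedBall) Metric.isClosed_closedBall).trans
      -- `C₁` bounds the `L¹` norm, `1` the variation inside the ball, and `C₂ * C₁` the far
      -- variation through the `L¹` norm.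
      (Metric.closedBall_subset_ball ?_), hΩb.isCompact_closure⟩, C₁ + 1 + C₂ * C₁,
    by positivity, fun u hu => ?_⟩
  · exact lt_of_lt_of_le (by linarith) (le_max_right _ _)
  have hμ := FracBV.isFracVariation_fracVariation hα₀ hα₁ hu.1
  have hui := hu.1.1
  have hu0 : ∀ᵐ x, x ∉ Metric.ball (0 : EuclideanSpace ℝ (Fin n)) R → u x = 0 :=
    hu.2.mono fun x hx hxR => hx fun hxΩ => hxR (hΩR hxΩ)
  have hfin : IsFiniteMeasure (FracBV.fracVariation α u).variation := ⟨hμ.1⟩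
  rw [FracBV.bvNorm, FracBV.totalFracVariation]
  set ν := (FracBV.fracVariation α u).variation with hν
  set v := ν.real (Metric.ball 0 r) with hv
  have hv0 : 0 ≤ v := measureReal_nonneg
  have hL1 : ∫ x, |u x| ≤ C₁ * v := (hpoinc u _ hui hu0 hμ).trans
    (mul_le_mul_of_nonneg_left (measureReal_mono (Metric.closedBall_subset_ball
      (lt_of_lt_of_le (by linarith) (le_max_left _ _)))) hC₁)
  have hfar' := hfar u _ hui hu0 hμ
  have hνv : ν (Metric.ball 0 r) = ENNReal.ofReal v := (ofReal_measureReal).symm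
  have huniv : ν Set.univ ≤ ENNReal.ofReal (v + C₂ * (C₁ * v)) := by
    have hsub : (Set.univ : Set (EuclideanSpace ℝ (Fin n))) ⊆
        Metric.ball 0 r ∪ {y | 2 * R < ‖y‖} := by
      intro y _
      by_cases hy : 2 * R < ‖y‖
      · exact Or.inr hy
      · refine Or.inl (mem_ball_zero_iff.2 (lt_of_lt_of_le ?_ (le_max_right _ _)))
        linarith
    refine (measure_mono hsub).trans ((measure_union_le _ _).trans ?_)
    rw [ENNReal.ofReal_add hv0 (by positivity), hνv]
    gcongr
    exact hfar'.trans (ENNReal.ofReal_le_ofReal (mul_le_mul_of_nonneg_left hL1 hC₂))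
  have hnorm : eLpNorm u 1 volume ≤ ENNReal.ofReal (C₁ * v) := by
    rw [eLpNorm_one_eq_lintegral_enorm, ← ofReal_integral_norm_eq_lintegral_enorm hui]
    exact ENNReal.ofReal_le_ofReal hL1
  rw [hνv, ← ENNReal.ofReal_mul (by positivity)]
  refine (add_le_add hnorm huniv).trans ?_
  rw [← ENNReal.ofReal_add (by positivity) (by positivity)]
  exact ENNReal.ofReal_le_ofReal (le_of_eq (by ring))
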